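/- Let $X$ be a non-empty zero-dimensional compact metrizable space (zero-dimensional: the clopen sets form a base). For a set $\mathcal F$ of continuous self-maps of $X$ put $\mathcal F^{\circ 0}=\{\mathrm{id}_X\}$ and $\mathcal F^{\circ k}=\{f_1\circ\dots\circ f_k: f_1,\dots,f_k\in\mathcal F\}$ for $k\ge 1$. The pair $(X,\mathcal F)$ is a topological fractal if $\mathcal F$ is finite, $X=\bigcup_{f\in\mathcal F}f(X)$, and for every open cover $\mathcal U$ of $X$ there is $n$ such that for every $f\in\mathcal F^{\circ n}$ the set $f(X)$ is contained in some $U\in\mathcal U$. It is a strict topological ultrafractal if, moreover, for all $k\ge 0$ and all $f,g\in\mathcal F^{\circ k}$ one has $f(X)=g(X)$, or $f(X)\cap g(X)=\emptyset$, or $|f(X)|=1$, or $|g(X)|=1$. For $\varepsilon>0$, an $\varepsilon$-contraction of $\mathbb R$ is a map $f:\mathbb R\to\mathbb R$ with Lipschitz constant $\mathrm{Lip}(f)\le\varepsilon$ and $\mathrm{Lip}(f)<1$; the attractor of a finite non-empty set $\mathcal F$ of such maps is the unique non-empty compact set $K\subset\mathbb R$ with $K=\bigcup_{f\in\mathcal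 F}f(K)$. For a set $A\subset X$ let $A^{(1)}$ be the set of non-isolated points of the subspace $A$; put $X^{(0)}=X$ and $X^{(\alpha)}=\bigcap_{\beta<\alpha}(X^{(\beta)})^{(1)}$ for every ordinal $\alpha>0$. The scattered height of a countable $X$ is $\hbar(X)=\min\{\alpha: X^{(\alpha)}\text{ is finite}\}$. Theorem. The following conditions are equivalent: 1. $(X,\mathcal F)$ is a topological fractal for some $\mathcal F$; 2. $(X,\mathcal F)$ is a strict topological ultrafractal for some $\mathcal F$ with $|\mathcal F|=3$ (or, if $X$ has fewer than three points, with $|\mathcal F|\le 3$); 3. for every $\varepsilon>0$, $X$ is homeomorphic to the attractor of a set of exactly three $\varepsilon$-contractions of $\mathbb R$; 4. either $X$ is uncountable, or $X$ is countable and $\hbar(X)$ is not a limit ordinal (here $0$ is not a limit ordinal). -/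

import Mathlib

universe u

open Topology
open scoped NNReal

namespace FractalThm

/-- A space is zero-dimensional if its clopen subsets form a base of the topology. -/
def IsZeroDimensional (X : Type*) [TopologicalSpace X] : Prop :=
  TopologicalSpace.IsTopologicalBasis {s : Set X | IsClopen s}

section Systems

variable {X : Type*} [TopologicalSpace X]

/-- The family of all `k`-fold compositions of members of `F`
(for `k = 0` it consists of the identity map only). -/
def iterComp (F : Set C(X, X)) : ℕ → Set C(X, X)
  | 0 => {ContinuousMap.id X}
  | k + 1 => {h | ∃ f ∈ F, ∃ g ∈ iterComp F k, h = f.comp g}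

/-- For every open cover there is `n` such that the image of `X` under each `n`-fold composition
of members of `F` lies in a member of the cover. -/
def IsTopologicallyContracting (F : Set C(X, X)) : Prop :=
  ∀ 𝒰 : Set (Set X), (∀ U ∈ 𝒰, IsOpen U) → ⋃₀ 𝒰 = Set.univ →
    ∃ n : ℕ, ∀ f ∈ iterComp F n, ∃ U ∈ 𝒰, Set.range f ⊆ U

/-- `(X, F)` is a topological fractal. -/
structure IsTopologicalFractal [CompactSpace X] [T2Space X] (F : Set C(X, X)) : Prop where
  finite : F.Finite
  contracting : IsTopologicallyContracting F
  cover : ⋃ f ∈ F, Set.range f = Set.univ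

/-- `(X, F)` is a strict topological ultrafractal. -/
structure IsStrictTopologicalUltrafractal [CompactSpace X] [T2Space X]
    (F : Set C(X, X)) : Prop extends IsTopologicalFractal F where
  strict : ∀ k : ℕ, ∀ f ∈ iterComp F k, ∀ g ∈ iterComp F k,
    Set.range f = Set.range g ∨ Set.range f ∩ Set.range g = ∅ ∨
      (Set.range f).ncard = 1 ∨ (Set.range g).ncard = 1

end Systems

section Attractors

variable {E : Type*} [MetricSpace E]

/-- A self-map that is contracting (Lipschitz constant `< 1`) with Lipschitz constant at
most `ε`. -/
def IsEpsContraction (ε : ℝ) (f : E → E) : Prop :=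
  ∃ L : ℝ≥0, L < 1 ∧ (L : ℝ) ≤ ε ∧ LipschitzWith L f

/-- `K` is the attractor of the system `F`: the nonempty compact set with
`K = ⋃ f ∈ F, f(K)`. For a nonempty finite system of contracting self-maps of a complete metric
space there is exactly one such set. -/
def IsAttractor (F : Set (E → E)) (K : Set E) : Prop :=
  K.Nonempty ∧ IsCompact K ∧ K = ⋃ f ∈ F, f '' K

end Attractors

/-- The scattered height of `X`: the least ordinal `α` for which the `α`-th derived set
`X^(α) = ⋂ β < α, (X^(β))^(1)` of `X` is finite, where `A^(1)` is the set of non-isolated points of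
the subspace `A`. (In a scattered compact space, hence in every countable compact metrizable space,
there is such an ordinal.) -/
noncomputable def scatteredHeight (X : Type u) [TopologicalSpace X] : Ordinal.{u} :=
  sInf {α : Ordinal.{u} | (CantorBendixson.iteratedDerivedSet (Set.univ : Set X) α).Finite}

end FractalThm

/-! ### Words, cylinders and retractions onto closed sets of words -/

namespace FractalThm

open Set PiNat

/-! Everything positive comes from a coding: under condition 4, `exists_shift_code` realises X as a
closed set S of words over three letters that is stable under deleting the first letter. For each
letter i with {u : iu ∈ S} non-empty, retract all words onto that set and then prefix i; the images
cover S because every word is its first letter followed by its tail. The retraction is chosen so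
that each map sends a cylinder to a point or onto a cylinder one letter longer
(`exists_cylinder_maps`). Cylinders of equal length coincide or are disjoint, which gives
strictness. Reading words as base-a expansions (`realCode`) makes the maps 6a-Lipschitz on a subset
of the line, and they extend to contractions of ℝ. Maps constant on the coded set pad the system to
three members.

For uncountable X the code uses a Cantor set in X: the words without the letter 2 are all codes, and
every other point is coded by a binary prefix, a 2, and a binary word. Nested embeddings of the
Cantor square leave room for the shifted words (`exists_shift_code_of_uncountable`). For countable
X, a Mazurkiewicz–Sierpiński style exhaustion by Cantor–Bendixson rank identifies X with a standard
set of words. When the height is γ + 1, the pieces around each top point can all be given rank γ,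
and this makes the standard set shift-stable; at height 0 there are no pieces.

Conversely, suppose the height l of a topological fractal is a limit. The finite set X^(l) has
disjoint neighbourhoods, and for suitable α < l a point y of X^(α) outside X^(l) lies in the
neighbourhood of some q in X^(l). Pulling y back through the maps inside X^(α), with its companion q
alongside, puts y and q together in images of arbitrarily long compositions. This contradicts
contraction (`IsTopologicalFractal.not_isSuccLimit_scatteredHeight`). -/

/-- One-sided infinite words over three letters. -/
abbrev Word : Type := ℕ → Fin 3

/-- The sequence whose first `n` letters are those of `a`, whose `n`-th letter is `d`, and which
continues with `u`. -/
def splice (n : ℕ) (a : Word) (d : Fin 3) (u : Word) : Word :=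
  fun k => if k < n then a k else if k = n then d else u (k - n - 1)

/-- The word `x` with its first letter removed. -/
def tail (x : Word) : Word := fun k => x (k + 1)

/-- The word `x` preceded by the letter `d`. -/
def cons (d : Fin 3) (x : Word) : Word := splice 0 x d x

@[simp] lemma cons_zero (d : Fin 3) (x : Word) : cons d x 0 = d := by simp [cons, splice]

@[simp] lemma cons_succ (d : Fin 3) (x : Word) (k : ℕ) : cons d x (k + 1) = x k := by
  simp [cons, splice]

@[simp] lemma tail_cons (d : Fin 3) (x : Word) : tail (cons d x) = x := by
  funext k; simp [tail]

lemma cons_tail (x : Word) : cons (x 0) (tail x) = x := by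
  funext k; cases k <;> simp [tail]

lemma cons_mem_cylinder {d : Fin 3} {x y : Word} {k : ℕ} :
    cons d y ∈ cylinder (cons d x) (k + 1) ↔ y ∈ cylinder x k := by
  simp only [mem_cylinder_iff]
  constructor
  · intro h i hi
    simpa using h (i + 1) (by omega)
  · intro h i hi
    cases i with
    | zero => simp
    | succ i => simpa using h i (by omega)

lemma continuous_cons (d : Fin 3) : Continuous (cons d) := by
  refine continuous_pi fun k => ?_
  cases k with
  | zero => simpa using continuous_const
  | succ k => simpa using continuous_apply k

lemma continuous_of_mem_cylinder {X : Type*} [TopologicalSpace X] {h : X → Word}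
    (H : ∀ x k, ∀ᶠ y in 𝓝 x, h y ∈ cylinder (h x) k) : Continuous h := by
  refine continuous_pi fun k => continuous_iff_continuousAt.2 fun x => ?_
  refine tendsto_nhds_of_eventually_eq ?_
  filter_upwards [H x (k + 1)] with y hy
  exact hy k (by omega)

/-- A closed set of words is a retract of the space of all words under a map that is constant on
every cylinder missing the set and maps every other cylinder into itself. -/
lemma exists_word_retraction {S : Set Word} (hS : IsClosed S) (hne : S.Nonempty) :
    ∃ ρ : Word → Word, (∀ x, ρ x ∈ S) ∧ (∀ x ∈ S, ρ x = x) ∧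
      (∀ x k, (S ∩ cylinder x k).Nonempty → ρ x ∈ cylinder x k) ∧
      ∀ x k, ¬ (S ∩ cylinder x k).Nonempty → ∀ y ∈ cylinder x k, ρ y = ρ x := by
  classical
  obtain ⟨p, hp⟩ := hne
  let c : Set Word → Word := fun A => if h : (S ∩ A).Nonempty then h.some else p
  have hc : ∀ A, (S ∩ A).Nonempty → c A ∈ S ∩ A := fun A h => by
    simp only [c, dif_pos h]; exact h.some_mem
  have hcS : ∀ A, c A ∈ S := fun A => by
    by_cases h : (S ∩ A).Nonempty
    · exact (hc A h).1
    · simpa only [c, dif_neg h] using hp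
  have hex : ∀ x ∉ S, ∃ k, ¬ (S ∩ cylinder x k).Nonempty := fun x hx => by
    obtain ⟨k, hk⟩ := exists_disjoint_cylinder hS hx
    exact ⟨k, by rwa [not_nonempty_iff_eq_empty, ← disjoint_iff_inter_eq_empty]⟩
  -- A point off S goes to a chosen point of S in the longest cylinder around it that still meets S.
  -- The choice depends only on the cylinder as a set, so it is constant on cylinders missing S.
  let ρ : Word → Word := fun x =>
    if hx : x ∈ S then x else c (cylinder x (Nat.find (hex x hx) - 1))
  refine ⟨ρ, fun x => ?_, fun x hx => by simp [ρ, hx], fun x k hk => ?_, fun x k hk y hy => ?_⟩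
  · by_cases hx : x ∈ S
    · simpa only [ρ, dif_pos hx]
    · simpa only [ρ, dif_neg hx] using hcS _
  · by_cases hx : x ∈ S
    · simp [ρ, dif_pos hx]
    · simp only [ρ, dif_neg hx]
      set n := Nat.find (hex x hx) with hn
      have h1 : k ≤ n - 1 := by
        have : k < n := by
          by_contra! h
          exact Nat.find_spec (hex x hx)
            (hk.mono (inter_subset_inter_right _ (cylinder_anti x h)))
        omega
      have h2 : (S ∩ cylinder x (n - 1)).Nonempty := by
        rcases Nat.eq_zero_or_pos n with h0 | h0
        · exact ⟨p, hp, by simp [h0]⟩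
        · exact not_not.1 (Nat.find_min (hex x hx) (m := n - 1) (by omega))
      exact cylinder_anti x h1 (hc _ h2).2
  · have hyx : cylinder y k = cylinder x k := mem_cylinder_iff_eq.1 hy
    have hx' : x ∉ S := fun h => hk ⟨x, h, self_mem_cylinder x k⟩
    have hy' : y ∉ S := fun h => hk ⟨y, h, hy⟩
    simp only [ρ, dif_neg hx', dif_neg hy']
    have hcyl : ∀ j ≤ k, cylinder y j = cylinder x j := fun j hj =>
      mem_cylinder_iff_eq.1 (cylinder_anti x hj hy)
    have hfx : Nat.find (hex x hx') ≤ k := Nat.find_min' _ hk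
    have hfy : Nat.find (hex y hy') ≤ k := Nat.find_min' _ (by rwa [hyx])
    have : Nat.find (hex y hy') = Nat.find (hex x hx') := by
      apply le_antisymm
      · exact Nat.find_min' _ (by rw [hcyl _ hfx]; exact Nat.find_spec (hex x hx'))
      · exact Nat.find_min' _ (by rw [← hcyl _ hfy]; exact Nat.find_spec (hex y hy'))
    rw [this, hcyl _ (by omega)]

/-! ### Maps that refine cylinders -/

section Coded

variable {X : Type u}

/-- With respect to a coding `e` of points by words, `f` maps every cylinder of length `k` either
to a point or onto a cylinder of length `k + s`. -/
def IsCylinderMap (e : X → Word) (s : ℕ) (f : X → X) : Prop :=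
  ∀ x k, (f '' (e ⁻¹' cylinder (e x) k)).Subsingleton ∨
    f '' (e ⁻¹' cylinder (e x) k) = e ⁻¹' cylinder (e (f x)) (k + s)

variable {e : X → Word}

lemma IsCylinderMap.mem_cylinder {s : ℕ} {f : X → X} (hf : IsCylinderMap e s f) {x y : X} {k : ℕ}
    (h : e y ∈ cylinder (e x) k) : e (f y) ∈ cylinder (e (f x)) (k + s) := by
  have hy : f y ∈ f '' (e ⁻¹' cylinder (e x) k) := mem_image_of_mem f h
  have hx : f x ∈ f '' (e ⁻¹' cylinder (e x) k) := mem_image_of_mem f (self_mem_cylinder _ _)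
  rcases hf x k with h1 | h1
  · rw [h1 hy hx]; exact self_mem_cylinder _ _
  · rw [h1] at hy; exact hy

lemma IsCylinderMap.comp {s t : ℕ} {f g : X → X} (hf : IsCylinderMap e s f)
    (hg : IsCylinderMap e t g) : IsCylinderMap e (t + s) (f ∘ g) := by
  intro x k
  rw [image_comp]
  rcases hg x k with h | h
  · exact Or.inl (h.image f)
  · rw [h, ← add_assoc]; exact hf (g x) (k + t)

lemma isCylinderMap_id : IsCylinderMap e 0 (id : X → X) := fun x k => Or.inr (by simp)

lemma isCylinderMap_const (s : ℕ) (p : X) : IsCylinderMap e s (fun _ => p) := fun x k =>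
  Or.inl (by rintro _ ⟨_, _, rfl⟩ _ ⟨_, _, rfl⟩; rfl)

lemma isCylinderMap_iterComp [TopologicalSpace X] {F : Set C(X, X)} (hF : ∀ f ∈ F, IsCylinderMap e 1 f) :
    ∀ k, ∀ f ∈ iterComp F k, IsCylinderMap e k f
  | 0, f, hf => by
    obtain rfl : f = ContinuousMap.id X := hf
    exact isCylinderMap_id
  | k + 1, f, hf => by
    obtain ⟨g, hg, h, hh, rfl⟩ := hf
    exact (hF g hg).comp (isCylinderMap_iterComp hF k h hh)

lemma IsCylinderMap.range_eq_or [Nonempty X] {k : ℕ} {f : X → X} (hf : IsCylinderMap e k f) :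
    (range f).ncard = 1 ∨ ∃ x, range f = e ⁻¹' cylinder (e x) k := by
  obtain ⟨x⟩ := ‹Nonempty X›
  have := hf x 0
  simp only [cylinder_zero, preimage_univ, image_univ, zero_add] at this
  refine this.imp (fun h => ?_) fun h => ⟨_, h⟩
  rw [ncard_eq_one]
  exact ⟨f x, h.eq_singleton_of_mem (mem_range_self x)⟩

/-- The whole space is the cylinder of length 0, so each range is a point or a cylinder of length k,
and two cylinders of the same length that meet are equal. -/
lemma strict_of_isCylinderMap [Nonempty X] {k : ℕ} {f g : X → X} (hf : IsCylinderMap e k f)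
    (hg : IsCylinderMap e k g) : range f = range g ∨ range f ∩ range g = ∅ ∨
      (range f).ncard = 1 ∨ (range g).ncard = 1 := by
  rcases hf.range_eq_or with h | ⟨x, hx⟩
  · exact Or.inr (Or.inr (Or.inl h))
  rcases hg.range_eq_or with h | ⟨y, hy⟩
  · exact Or.inr (Or.inr (Or.inr h))
  by_cases h : (range f ∩ range g).Nonempty
  · left
    obtain ⟨z, hz1, hz2⟩ := h
    rw [hx] at hz1 ⊢
    rw [hy] at hz2 ⊢
    rw [← mem_cylinder_iff_eq.1 hz1, ← mem_cylinder_iff_eq.1 hz2]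
  · exact Or.inr (Or.inl (not_nonempty_iff_eq_empty.1 h))

/-- A compact space coded by a shift-invariant set of words is covered by the images of three
maps that refine cylinders. -/
lemma exists_cylinder_maps [TopologicalSpace X] [CompactSpace X] [Nonempty X] (he : Continuous e)
    (hinj : Function.Injective e) (hshift : ∀ x, tail (e x) ∈ range e) :
    ∃ f : Fin 3 → C(X, X), (∀ i, IsCylinderMap e 1 (f i)) ∧ ∀ x, ∃ i, x ∈ range (f i) := by
  have hemb := he.isClosedEmbedding hinj
  have key : ∀ i : Fin 3, ∃ f : C(X, X), IsCylinderMap e 1 f ∧ ∀ x, e x 0 = i → x ∈ range f := by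
    intro i
    let S : Set Word := cons i ⁻¹' range e
    by_cases hne : S.Nonempty
    swap
    · refine ⟨ContinuousMap.const X (Classical.arbitrary X), isCylinderMap_const _ _,
        fun x hx => (hne ⟨tail (e x), x, ?_⟩).elim⟩
      rw [← hx, cons_tail]
    -- The map is x ↦ iρ(x) in terms of codes. On a cylinder meeting S, surjectivity onto the longer
    -- cylinder holds because the tail of a target point is a code lying in S, where ρ is the
    -- identity.
    obtain ⟨ρ, hρS, hρid, hρ1, hρ2⟩ :=
      exists_word_retraction (hemb.isClosed_range.preimage (continuous_cons i)) hne
    choose f hf using fun x => hρS (e x)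
    have hcyl : IsCylinderMap e 1 f := by
      intro x k
      by_cases hk : (S ∩ cylinder (e x) k).Nonempty
      · right
        have hmem : ∀ y, e y ∈ cylinder (e x) k → ρ (e y) ∈ cylinder (e x) k := fun y hy => by
          rw [← mem_cylinder_iff_eq.1 hy] at hk ⊢
          exact hρ1 _ _ hk
        have hx := hmem x (self_mem_cylinder _ _)
        ext z
        constructor
        · rintro ⟨y, hy, rfl⟩
          rw [mem_preimage, hf, hf, cons_mem_cylinder, mem_cylinder_iff_eq.1 hx]
          exact hmem y hy
        · intro hz
          rw [mem_preimage, hf] at hz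
          have hz0 : e z 0 = i := by simpa using hz 0 (by omega)
          obtain ⟨y, hy⟩ := hshift z
          have hzc : cons i (tail (e z)) = e z := by rw [← hz0, cons_tail]
          rw [← hzc, cons_mem_cylinder, ← hy, mem_cylinder_iff_eq.1 hx] at hz
          refine ⟨y, hz, hinj ?_⟩
          rw [hf, hρid _ (by rw [hy]; exact ⟨z, hzc.symm⟩), hy, hzc]
      · left
        rintro _ ⟨y, hy, rfl⟩ _ ⟨z, hz, rfl⟩
        exact hinj (by rw [hf, hf, hρ2 _ _ hk _ hy, hρ2 _ _ hk _ hz])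
    have hcont : Continuous f := by
      refine hemb.isInducing.continuous_iff.2 (continuous_of_mem_cylinder fun x k => ?_)
      have : ∀ᶠ y in 𝓝 x, e y ∈ cylinder (e x) k :=
        he.continuousAt ((isOpen_cylinder _ (e x) k).mem_nhds (self_mem_cylinder _ _))
      filter_upwards [this] with y hy
      exact cylinder_anti _ (by omega) (hcyl.mem_cylinder hy)
    refine ⟨⟨f, hcont⟩, hcyl, fun z hz => ?_⟩
    obtain ⟨y, hy⟩ := hshift z
    have hzc : cons i (tail (e z)) = e z := by rw [← hz, cons_tail]
    refine ⟨y, hinj ?_⟩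
    rw [ContinuousMap.coe_mk, hf, hρid _ (by rw [hy]; exact ⟨z, hzc.symm⟩), hy, hzc]
  choose f hf1 hf2 using key
  exact ⟨f, hf1, fun x => ⟨e x 0, hf2 _ x rfl⟩⟩

end Coded

end FractalThm

/-! ### Base-a expansions and contractions of the line -/

namespace FractalThm

open Set PiNat

section RealCode

/-- The real number with base-`a` expansion given by a word. -/
noncomputable def realCode (a : ℝ) (x : Word) : ℝ := ∑' i, ((x i : ℕ) : ℝ) * a ^ i

variable {a : ℝ}

lemma letter_le_two (d : Fin 3) : ((d : ℕ) : ℝ) ≤ 2 := by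
  have : (d : ℕ) ≤ 2 := by omega
  exact_mod_cast this

lemma summable_two_mul_pow (h0 : 0 < a) (h1 : a ≤ 1 / 8) : Summable fun i : ℕ => 2 * a ^ i :=
  (summable_geometric_of_lt_one h0.le (by linarith)).mul_left 2

lemma summable_realCode (h0 : 0 < a) (h1 : a ≤ 1 / 8) (x : Word) :
    Summable fun i => ((x i : ℕ) : ℝ) * a ^ i :=
  Summable.of_nonneg_of_le (fun i => by positivity)
    (fun i => mul_le_mul_of_nonneg_right (letter_le_two _) (by positivity))
    (summable_two_mul_pow h0 h1)

lemma realCode_nonneg (h0 : 0 < a) (x : Word) : 0 ≤ realCode a x :=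
  tsum_nonneg fun i => by positivity

lemma realCode_le (h0 : 0 < a) (h1 : a ≤ 1 / 8) (x : Word) : realCode a x ≤ 3 := by
  have h2 : realCode a x ≤ ∑' i : ℕ, 2 * a ^ i :=
    (summable_realCode h0 h1 x).tsum_le_tsum
      (fun i => mul_le_mul_of_nonneg_right (letter_le_two _) (by positivity))
      (summable_two_mul_pow h0 h1)
  rw [tsum_mul_left, tsum_geometric_of_lt_one h0.le (by linarith)] at h2
  refine h2.trans ?_
  rw [← div_eq_mul_inv, div_le_iff₀ (by linarith)]
  linarith

lemma realCode_eq (h0 : 0 < a) (h1 : a ≤ 1 / 8) (x : Word) :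
    realCode a x = (x 0 : ℕ) + a * realCode a (tail x) := by
  rw [realCode, (summable_realCode h0 h1 x).tsum_eq_zero_add, realCode, ← tsum_mul_left]
  simp [tail, pow_succ', mul_left_comm]

lemma tail_mem_cylinder {x y : Word} {n : ℕ} (h : y ∈ cylinder x (n + 1)) :
    tail y ∈ cylinder (tail x) n := fun i hi => h (i + 1) (by omega)

lemma abs_realCode_sub_le (h0 : 0 < a) (h1 : a ≤ 1 / 8) :
    ∀ {n : ℕ} {x y : Word}, y ∈ cylinder x n → |realCode a x - realCode a y| ≤ 3 * a ^ n
  | 0, x, y, _ => by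
    rw [abs_le]
    have := realCode_nonneg h0 x
    have := realCode_nonneg h0 y
    have := realCode_le h0 h1 x
    have := realCode_le h0 h1 y
    constructor <;> linarith
  | n + 1, x, y, h => by
    have ih := abs_realCode_sub_le h0 h1 (tail_mem_cylinder h)
    rw [realCode_eq h0 h1 x, realCode_eq h0 h1 y, h 0 (by omega), add_sub_add_left_eq_sub,
      ← mul_sub, abs_mul, abs_of_pos h0, pow_succ]
    nlinarith

/-- At the first disagreement the letters differ by at least 1, while the remaining digits
contribute at most 3a ≤ 3/8; after n common letters everything is scaled by a ^ n. -/
lemma le_abs_realCode_sub (h0 : 0 < a) (h1 : a ≤ 1 / 8) :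
    ∀ {n : ℕ} {x y : Word}, y ∈ cylinder x n → x n ≠ y n →
      a ^ n / 2 ≤ |realCode a x - realCode a y|
  | 0, x, y, _, hne => by
    have h3 : |realCode a (tail x) - realCode a (tail y)| ≤ 3 := by
      simpa using abs_realCode_sub_le h0 h1 (n := 0) (x := tail x) (y := tail y) (by simp)
    have h4 : (1 : ℝ) ≤ |((x 0 : ℕ) : ℝ) - ((y 0 : ℕ) : ℝ)| := by
      have : (1 : ℤ) ≤ |((x 0 : ℕ) : ℤ) - ((y 0 : ℕ) : ℤ)| := by
        refine Int.one_le_abs (sub_ne_zero.2 fun h => hne (Fin.ext ?_))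
        exact_mod_cast h
      exact_mod_cast this
    have h5 : ((x 0 : ℕ) : ℝ) - ((y 0 : ℕ) : ℝ) = (realCode a x - realCode a y) -
        a * (realCode a (tail x) - realCode a (tail y)) := by
      rw [realCode_eq h0 h1 x, realCode_eq h0 h1 y]; ring
    have h6 := abs_sub (realCode a x - realCode a y)
      (a * (realCode a (tail x) - realCode a (tail y)))
    rw [← h5, abs_mul, abs_of_pos h0] at h6
    rw [pow_zero]
    nlinarith [abs_nonneg (realCode a (tail x) - realCode a (tail y))]
  | n + 1, x, y, h, hne => by
    have ih := le_abs_realCode_sub h0 h1 (tail_mem_cylinder h) (x := tail x) (y := tail y) hne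
    rw [realCode_eq h0 h1 x, realCode_eq h0 h1 y, h 0 (by omega), add_sub_add_left_eq_sub,
      ← mul_sub, abs_mul, abs_of_pos h0, pow_succ]
    nlinarith

lemma continuous_realCode (h0 : 0 < a) (h1 : a ≤ 1 / 8) : Continuous (realCode a) := by
  refine continuous_tsum (fun i => ?_) (summable_two_mul_pow h0 h1) fun i x => ?_
  · exact ((continuous_of_discreteTopology (f := fun d : Fin 3 => ((d : ℕ) : ℝ))).comp
      (continuous_apply i)).mul continuous_const
  · rw [Real.norm_of_nonneg (by positivity)]
    exact mul_le_mul_of_nonneg_right (letter_le_two _) (by positivity)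

/-- If the codes first differ at position n, the images agree on n + 1 letters. The factor 6a is the
quotient of the upper bound 3a ^ (n + 1) by the lower bound a ^ n / 2. -/
lemma abs_realCode_map_sub_le {X : Type*} (h0 : 0 < a) (h1 : a ≤ 1 / 8) {e : X → Word}
    (hinj : Function.Injective e) {f : X → X} (hf : IsCylinderMap e 1 f) (x y : X) :
    |realCode a (e (f x)) - realCode a (e (f y))| ≤
      6 * a * |realCode a (e x) - realCode a (e y)| := by
  rcases eq_or_ne x y with rfl | hxy
  · simp
  have hne : e x ≠ e y := hinj.ne hxy
  have hmem : e y ∈ cylinder (e x) (firstDiff (e x) (e y)) := by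
    rw [mem_cylinder_comm]; exact mem_cylinder_firstDiff _ _
  have h2 := abs_realCode_sub_le h0 h1 (hf.mem_cylinder hmem)
  have h3 := le_abs_realCode_sub h0 h1 hmem (apply_firstDiff_ne hne)
  rw [pow_succ] at h2
  nlinarith

lemma injective_realCode (h0 : 0 < a) (h1 : a ≤ 1 / 8) : Function.Injective (realCode a) := by
  intro x y hxy
  by_contra hne
  have hmem : y ∈ cylinder x (firstDiff x y) := by
    rw [mem_cylinder_comm]; exact mem_cylinder_firstDiff _ _
  have h3 := le_abs_realCode_sub h0 h1 hmem (apply_firstDiff_ne hne)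
  rw [hxy, sub_self, abs_zero] at h3
  have : 0 < a ^ firstDiff x y := by positivity
  linarith

end RealCode

section Contracting

variable {X : Type u} [TopologicalSpace X]

lemma iterComp_abs_sub_le {h : X → ℝ} {L : ℝ} (hL : 0 ≤ L) {F : Set C(X, X)}
    (hF : ∀ f ∈ F, ∀ x y, |h (f x) - h (f y)| ≤ L * |h x - h y|) :
    ∀ k, ∀ f ∈ iterComp F k, ∀ x y, |h (f x) - h (f y)| ≤ L ^ k * |h x - h y|
  | 0, f, hf, x, y => by
    obtain rfl : f = ContinuousMap.id X := hf
    simp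
  | k + 1, f, hf, x, y => by
    obtain ⟨f, hf, g, hg, rfl⟩ := hf
    have ih := iterComp_abs_sub_le hL hF k g hg x y
    calc |h (f (g x)) - h (f (g y))| ≤ L * |h (g x) - h (g y)| := hF f hf _ _
      _ ≤ L * (L ^ k * |h x - h y|) := mul_le_mul_of_nonneg_left ih hL
      _ = L ^ (k + 1) * |h x - h y| := by ring

/-- Transport the cover to the compact image of `h` and take a Lebesgue number δ; compositions long
enough have image of radius below δ. -/
lemma isTopologicallyContracting_of_abs_sub_le [CompactSpace X] [Nonempty X] {h : X → ℝ}
    (hc : Continuous h) (hinj : Function.Injective h) {L : ℝ} (hL : 0 ≤ L) (hL1 : L < 1)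
    {F : Set C(X, X)} (hF : ∀ f ∈ F, ∀ x y, |h (f x) - h (f y)| ≤ L * |h x - h y|) :
    IsTopologicallyContracting F := by
  intro 𝒰 hop hcov
  have hemb := hc.isClosedEmbedding hinj
  have hK : IsCompact (range h) := isCompact_range hc
  obtain ⟨δ, hδ, hleb⟩ := lebesgue_number_lemma_of_metric_sUnion (s := range h)
    (c := {V | IsOpen V ∧ h ⁻¹' V ∈ 𝒰}) hK (fun V hV => hV.1) (by
      rintro _ ⟨x, rfl⟩
      obtain ⟨U, hU, hxU⟩ : x ∈ ⋃₀ 𝒰 := by rw [hcov]; trivial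
      obtain ⟨V, hV, hVU⟩ := hemb.isInducing.isOpen_iff.1 (hop U hU)
      refine ⟨V, ⟨hV, by rwa [hVU]⟩, ?_⟩
      rwa [← hVU] at hxU)
  obtain ⟨D, hD⟩ := hK.isBounded.exists_norm_le
  have hD' : ∀ x y, |h x - h y| ≤ 2 * D := fun x y => by
    have h1 := hD _ (mem_range_self x)
    have h2 := hD _ (mem_range_self y)
    rw [Real.norm_eq_abs] at h1 h2
    have := abs_sub (h x) (h y)
    linarith
  obtain ⟨x₀⟩ := ‹Nonempty X›
  have hD0 : 0 ≤ 2 * D := (abs_nonneg _).trans (hD' x₀ x₀)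
  obtain ⟨n, hn⟩ := exists_pow_lt_of_lt_one (show 0 < δ / (2 * D + 1) by positivity) hL1
  refine ⟨n, fun f hf => ?_⟩
  obtain ⟨V, ⟨-, hVU⟩, hball⟩ := hleb (h (f x₀)) (mem_range_self _)
  refine ⟨_, hVU, ?_⟩
  rintro _ ⟨x, rfl⟩
  refine hball ?_
  rw [Metric.mem_ball, Real.dist_eq]
  rw [lt_div_iff₀ (by positivity)] at hn
  have h1 := iterComp_abs_sub_le hL hF n f hf x x₀
  have h2 : L ^ n * |h x - h x₀| ≤ L ^ n * (2 * D) :=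
    mul_le_mul_of_nonneg_left (hD' _ _) (by positivity)
  have h3 : 0 ≤ L ^ n := by positivity
  linarith

end Contracting

section Shift

variable {X : Type u} [TopologicalSpace X] [CompactSpace X] [Nonempty X] {e : X → Word}

/-- A compact space coded by a shift-invariant set of words carries a strict topological
ultrafractal structure with three maps. -/
lemma exists_strictTopologicalUltrafractal [T2Space X] (he : Continuous e)
    (hinj : Function.Injective e) (hshift : ∀ x, tail (e x) ∈ range e) :
    ∃ F : Set C(X, X), IsStrictTopologicalUltrafractal F ∧
      (F.ncard = 3 ∨ (ENat.card X < 3 ∧ F.ncard ≤ 3)) := by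
  obtain ⟨f, hf, hcov⟩ := exists_cylinder_maps he hinj hshift
  have hstruct : ∀ F : Set C(X, X), F.Finite → range f ⊆ F → (∀ g ∈ F, IsCylinderMap e 1 g) →
      IsStrictTopologicalUltrafractal F := fun F hfin hsub hF => by
    refine ⟨⟨hfin, ?_, ?_⟩, fun k g hg g' hg' =>
      strict_of_isCylinderMap (isCylinderMap_iterComp hF k g hg)
        (isCylinderMap_iterComp hF k g' hg')⟩
    · have h0 : (0 : ℝ) < 1 / 8 := by norm_num
      exact isTopologicallyContracting_of_abs_sub_le
        ((continuous_realCode h0 le_rfl).comp he) ((injective_realCode h0 le_rfl).comp hinj)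
        (L := 6 * (1 / 8)) (by norm_num) (by norm_num)
        fun g hg => abs_realCode_map_sub_le h0 le_rfl hinj (hF g hg)
    · refine eq_univ_of_forall fun x => ?_
      obtain ⟨i, hi⟩ := hcov x
      exact mem_biUnion (hsub (mem_range_self i)) hi
  have hcard : (range f).encard ≤ 3 := by
    rw [← image_univ]
    exact (encard_image_le f univ).trans (by simp)
  by_cases h3 : ENat.card X < 3
  · refine ⟨range f, hstruct _ (finite_range f) subset_rfl (by rintro _ ⟨i, rfl⟩; exact hf i),
      Or.inr ⟨h3, ?_⟩⟩
    rw [ncard]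
    exact ENat.toNat_le_of_le_natCast hcard
  -- With at least three points there are at least three constant maps. Being cylinder maps, they
  -- may be added until the system has exactly three members.
  · have hconst : 3 ≤ (range f ∪ range (ContinuousMap.const X : X → C(X, X))).encard := by
      refine le_trans ?_ (encard_le_encard subset_union_right)
      have hci : Function.Injective (ContinuousMap.const X : X → C(X, X)) := fun x y hxy => by
        simpa using DFunLike.congr_fun hxy x
      rw [← image_univ, hci.encard_image, encard_univ]
      exact not_lt.1 h3
    obtain ⟨F, h1, h2, hF⟩ := exists_superset_subset_encard_eq subset_union_left hcard hconst
    refine ⟨F, hstruct F (finite_of_encard_eq_coe (k := 3) hF) h1 fun g hg => ?_,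
      Or.inl (by rw [ncard, hF]; rfl)⟩
    rcases h2 hg with ⟨i, rfl⟩ | ⟨p, rfl⟩
    · exact hf i
    · exact isCylinderMap_const 1 p

/-- Infinitely many contractions collapse a given compact set of reals to a given point. -/
lemma infinite_contractions_eq_const {ε : ℝ} (hε : 0 < ε) {K : Set ℝ} (hK : IsCompact K) (p : ℝ) :
    {g : ℝ → ℝ | IsEpsContraction ε g ∧ ∀ x ∈ K, g x = p}.Infinite := by
  obtain ⟨D, hD⟩ := hK.isBounded.exists_norm_le
  let L : ℝ≥0 := ⟨min ε (1 / 2), by positivity⟩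
  have hL1 : L < 1 := by
    rw [← NNReal.coe_lt_coe]
    exact (min_le_right _ _).trans_lt (by norm_num)
  have hL0 : (0 : ℝ) < L := lt_min hε (by norm_num)
  -- These equal p up to D + n, hence on K, and start to grow at different points beyond K.
  let g : ℕ → ℝ → ℝ := fun n x => p + L * max (x - (D + n)) 0
  refine infinite_of_injective_forall_mem (f := g) (fun m n hmn => ?_) fun n => ⟨?_, ?_⟩
  · by_contra hne
    wlog hlt : m < n generalizing m n
    · exact this n m hmn.symm (Ne.symm hne) (by omega)
    have h1 := congrFun hmn (D + n)
    have h2 : (m : ℝ) < n := by exact_mod_cast hlt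
    simp only [g, add_right_inj, sub_self, max_self, mul_zero, mul_eq_zero] at h1
    rcases h1 with h1 | h1
    · exact hL0.ne' h1
    · have := le_max_left (D + n - (D + m)) 0
      linarith
  · refine ⟨L, hL1, min_le_left _ _, LipschitzWith.of_dist_le_mul fun x y => ?_⟩
    rw [Real.dist_eq, Real.dist_eq]
    have h1 : g n x - g n y = L * (max (x - (D + n)) 0 - max (y - (D + n)) 0) := by
      simp only [g]; ring
    rw [h1, abs_mul, abs_of_pos hL0]
    refine mul_le_mul_of_nonneg_left ?_ hL0.le
    refine (abs_max_sub_max_le_abs _ _ _).trans (le_of_eq ?_)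
    congr 1; ring
  · intro x hx
    have h1 := hD x hx
    rw [Real.norm_eq_abs] at h1
    have h2 := le_abs_self x
    have h3 : (0 : ℝ) ≤ n := by positivity
    simp only [g]
    rw [max_eq_right (by linarith)]
    simp

/-- A compact space coded by a shift-invariant set of words is homeomorphic to the attractor of
three contractions of the line with arbitrarily small Lipschitz constants. -/
lemma exists_attractor_homeomorph (he : Continuous e) (hinj : Function.Injective e)
    (hshift : ∀ x, tail (e x) ∈ range e) {ε : ℝ} (hε : 0 < ε) :
    ∃ F : Set (ℝ → ℝ), F.ncard = 3 ∧ (∀ f ∈ F, IsEpsContraction ε f) ∧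
      ∃ K : Set ℝ, IsAttractor F K ∧ Nonempty (X ≃ₜ K) := by
  obtain ⟨f, hf, hcov⟩ := exists_cylinder_maps he hinj hshift
  let a : ℝ := min (ε / 6) (1 / 8)
  have h0 : 0 < a := lt_min (by positivity) (by norm_num)
  have h1 : a ≤ 1 / 8 := min_le_right _ _
  let h : X → ℝ := fun x => realCode a (e x)
  have hc : Continuous h := (continuous_realCode h0 h1).comp he
  have hi : Function.Injective h := (injective_realCode h0 h1).comp hinj
  have hK : IsCompact (range h) := isCompact_range hc
  let L : ℝ≥0 := ⟨6 * a, by positivity⟩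
  have hL1 : L < 1 := by
    rw [← NNReal.coe_lt_coe]
    show 6 * a < 1
    linarith
  have hLε : (L : ℝ) ≤ ε := by
    show 6 * a ≤ ε
    have : a ≤ ε / 6 := min_le_left _ _
    linarith
  have hext : ∀ i, ∃ g : ℝ → ℝ, IsEpsContraction ε g ∧ ∀ x, g (h x) = h (f i x) := fun i => by
    have hlip : LipschitzOnWith L (fun t => h (f i (Function.invFun h t))) (range h) := by
      refine LipschitzOnWith.of_dist_le_mul ?_
      rintro _ ⟨x, rfl⟩ _ ⟨y, rfl⟩
      simp only [Function.leftInverse_invFun hi _, Real.dist_eq]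
      exact abs_realCode_map_sub_le h0 h1 hinj (hf i) x y
    obtain ⟨g, hg, hgeq⟩ := hlip.extend_real
    refine ⟨g, ⟨L, hL1, hLε, hg⟩, fun x => ?_⟩
    rw [← hgeq (mem_range_self x)]
    simp only [Function.leftInverse_invFun hi _]
  choose g hg1 hg2 using hext
  obtain ⟨x₀⟩ := ‹Nonempty X›
  have hcard : (range g).encard ≤ 3 := by
    rw [← image_univ]
    exact (encard_image_le g univ).trans (by simp)
  obtain ⟨F, hF1, hF2, hF3⟩ := exists_superset_subset_encard_eq
    (t := range g ∪ {g : ℝ → ℝ | IsEpsContraction ε g ∧ ∀ x ∈ range h, g x = h x₀})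
    subset_union_left hcard (by
      refine le_trans ?_ (encard_le_encard subset_union_right)
      rw [(infinite_contractions_eq_const hε hK (h x₀)).encard_eq]
      exact le_top)
  refine ⟨F, by rw [ncard, hF3]; rfl, fun φ hφ => ?_, range h, ⟨⟨_, mem_range_self x₀⟩, hK, ?_⟩,
    ⟨(hc.isClosedEmbedding hi).isEmbedding.toHomeomorph⟩⟩
  · rcases hF2 hφ with ⟨i, rfl⟩ | hφ
    · exact hg1 i
    · exact hφ.1
  · refine Subset.antisymm ?_ (iUnion₂_subset fun φ hφ => ?_)
    · rintro _ ⟨x, rfl⟩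
      obtain ⟨i, y, rfl⟩ := hcov x
      exact mem_biUnion (hF1 (mem_range_self i)) ⟨h y, mem_range_self y, hg2 i y⟩
    · rintro _ ⟨_, ⟨x, rfl⟩, rfl⟩
      rcases hF2 hφ with ⟨i, rfl⟩ | hφ
      · rw [hg2]; exact mem_range_self _
      · rw [hφ.2 _ (mem_range_self x)]; exact mem_range_self _

/-- An attractor of finitely many contractions of the line is a topological fractal. -/
lemma exists_topologicalFractal_of_attractor [T2Space X] {ε : ℝ} (hε : 0 ≤ ε) (hε1 : ε < 1)
    {F : Set (ℝ → ℝ)} (hfin : F.Finite) (hF : ∀ f ∈ F, IsEpsContraction ε f) {K : Set ℝ}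
    (hK : IsAttractor F K) (h : X ≃ₜ K) : ∃ F : Set C(X, X), IsTopologicalFractal F := by
  have hmaps : ∀ f ∈ F, ∀ x : X, f (h x) ∈ K := fun f hf x => by
    exact hK.2.2.ge (mem_biUnion hf ⟨_, (h x).2, rfl⟩)
  have hcont : ∀ f ∈ F, Continuous f := fun f hf => by
    obtain ⟨L, -, -, hL⟩ := hF f hf
    exact hL.continuous
  let G : F → C(X, X) := fun f => ⟨fun x => h.symm ⟨f.1 (h x), hmaps _ f.2 x⟩, by
    have := hcont _ f.2
    fun_prop⟩
  have hG : ∀ f x, (h (G f x) : ℝ) = f.1 (h x) := fun f x => by simp [G]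
  have := hfin.to_subtype
  refine ⟨range G, finite_range G, ?_, eq_univ_of_forall fun x => ?_⟩
  · refine isTopologicallyContracting_of_abs_sub_le (h := fun x => (h x : ℝ))
      (by fun_prop) (Subtype.val_injective.comp h.injective) hε hε1 ?_
    rintro _ ⟨f, rfl⟩ x y
    obtain ⟨L, -, hLε, hL⟩ := hF _ f.2
    rw [hG, hG]
    have := hL.dist_le_mul (h x) (h y)
    rw [Real.dist_eq, Real.dist_eq] at this
    exact this.trans (mul_le_mul_of_nonneg_right hLε (abs_nonneg _))
  · have hx : (h x : ℝ) ∈ ⋃ f ∈ F, f '' K := by rw [← hK.2.2]; exact (h x).2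
    simp only [mem_iUnion, exists_prop] at hx
    obtain ⟨f, hf, t, ht, hft⟩ := hx
    refine mem_biUnion (mem_range_self ⟨f, hf⟩) ⟨h.symm ⟨t, ht⟩, h.injective (Subtype.ext ?_)⟩
    rw [hG]
    simpa using hft

end Shift

end FractalThm

/-! ### Derived sets of a topological fractal: the height is not a limit -/

namespace FractalThm

open Set CantorBendixson

variable {X : Type u} [TopologicalSpace X]

section IterComp

lemma mem_iterComp_add {F : Set C(X, X)} {n : ℕ} {f : C(X, X)} :
    ∀ {m : ℕ}, f ∈ iterComp F (m + n) ↔ ∃ g ∈ iterComp F m, ∃ h ∈ iterComp F n, f = g.comp h := by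
  intro m
  induction m generalizing f with
  | zero => simp [iterComp]
  | succ m ih =>
    rw [Nat.add_right_comm]
    constructor
    · rintro ⟨g, hg, h, hh, rfl⟩
      obtain ⟨h₁, hh₁, h₂, hh₂, rfl⟩ := ih.1 hh
      exact ⟨g.comp h₁, ⟨g, hg, h₁, hh₁, rfl⟩, h₂, hh₂, rfl⟩
    · rintro ⟨_, ⟨g, hg, h₁, hh₁, rfl⟩, h₂, hh₂, rfl⟩
      exact ⟨g, hg, h₁.comp h₂, ih.2 ⟨h₁, hh₁, h₂, hh₂, rfl⟩, rfl⟩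

lemma iterComp_iterComp_subset {F : Set C(X, X)} (n : ℕ) :
    ∀ k, iterComp (iterComp F n) k ⊆ iterComp F (k * n)
  | 0 => by simp [iterComp]
  | k + 1 => by
    rintro _ ⟨f, hf, g, hg, rfl⟩
    rw [add_mul, one_mul, add_comm]
    exact mem_iterComp_add.2 ⟨f, hf, g, iterComp_iterComp_subset n k hg, rfl⟩

lemma finite_iterComp {F : Set C(X, X)} (hF : F.Finite) : ∀ k, (iterComp F k).Finite
  | 0 => finite_singleton _
  | k + 1 => by
    refine (hF.image2 ContinuousMap.comp (finite_iterComp hF k)).subset ?_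
    rintro _ ⟨f, hf, g, hg, rfl⟩
    exact ⟨f, hf, g, hg, rfl⟩

lemma iterComp_cover {F : Set C(X, X)} (hF : ⋃ f ∈ F, range f = univ) :
    ∀ k, ⋃ f ∈ iterComp F k, range f = univ
  | 0 => by simp [iterComp]
  | k + 1 => by
    refine eq_univ_of_forall fun x => ?_
    obtain ⟨f, hf, y, rfl⟩ : ∃ f ∈ F, x ∈ range f := by simpa using hF.ge (mem_univ x)
    obtain ⟨g, hg, z, rfl⟩ : ∃ g ∈ iterComp F k, y ∈ range g := by
      simpa using (iterComp_cover hF k).ge (mem_univ y)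
    exact mem_biUnion ⟨f, hf, g, hg, rfl⟩ ⟨z, rfl⟩

lemma range_subset_of_iterComp_le {F : Set C(X, X)} {𝒰 : Set (Set X)} {m n : ℕ} (hmn : m ≤ n)
    (h : ∀ f ∈ iterComp F m, ∃ U ∈ 𝒰, range f ⊆ U) :
    ∀ f ∈ iterComp F n, ∃ U ∈ 𝒰, range f ⊆ U := by
  intro f hf
  obtain ⟨k, rfl⟩ := Nat.exists_eq_add_of_le hmn
  obtain ⟨g, hg, g', -, rfl⟩ := mem_iterComp_add.1 hf
  obtain ⟨U, hU, hgU⟩ := h g hg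
  exact ⟨U, hU, (range_comp_subset_range g' g).trans hgU⟩

end IterComp

section Derived

lemma mem_derivedSet_iff_mem_closure {A : Set X} {x : X} :
    x ∈ derivedSet A ↔ x ∈ closure (A \ {x}) := by
  rw [mem_derivedSet, accPt_principal_iff_clusterPt, mem_closure_iff_clusterPt]

/-- An accumulation point y of the image lies in the compact image of the closure of A \ f⁻¹{y}. Its
preimage there is approximated by points of A outside the fibre, hence different from it. -/
lemma derivedSet_image_subset [CompactSpace X] [T2Space X] {f : X → X} (hf : Continuous f)
    (A : Set X) : derivedSet (f '' A) ⊆ f '' derivedSet A := by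
  intro y hy
  rw [mem_derivedSet_iff_mem_closure] at hy
  have h1 : f '' A \ {y} ⊆ f '' (A \ f ⁻¹' {y}) := by
    rintro _ ⟨⟨z, hz, rfl⟩, hzy⟩
    exact ⟨z, ⟨hz, hzy⟩, rfl⟩
  have h2 : y ∈ f '' closure (A \ f ⁻¹' {y}) :=
    closure_minimal (h1.trans (image_mono subset_closure))
      (isClosed_closure.isCompact.image hf).isClosed hy
  obtain ⟨z, hz, rfl⟩ := h2
  refine ⟨z, mem_derivedSet_iff_mem_closure.2 (closure_mono ?_ hz), rfl⟩
  exact fun w hw => ⟨hw.1, fun h => hw.2 (congrArg f h)⟩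

lemma isClosed_iteratedDerivedSet_univ (α : Ordinal) :
    IsClosed (iteratedDerivedSet (univ : Set X) α) :=
  isClosed_iteratedDerivedSet isClosed_univ α

lemma iteratedDerivedSet_univ_succ (α : Ordinal) :
    iteratedDerivedSet (univ : Set X) (α + 1) =
      derivedSet (iteratedDerivedSet (univ : Set X) α) := by
  rw [iteratedDerivedSet_succ, (isClosed_iteratedDerivedSet_univ α).relDerivedSet_eq]

lemma exists_disjoint_iteratedDerivedSet [CompactSpace X] {α : Ordinal} (hα : Order.IsSuccLimit α)
    {C : Set X} (hC : IsClosed C) (hdisj : Disjoint C (iteratedDerivedSet (univ : Set X) α)) :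
    ∃ β < α, Disjoint C (iteratedDerivedSet (univ : Set X) β) := by
  have : Nonempty (Iio α) := hα.nonempty_Iio.to_subtype
  rw [iteratedDerivedSet_limit hα, disjoint_iff_inter_eq_empty] at hdisj
  obtain ⟨β, hβ⟩ := hC.isCompact.elim_directed_family_closed
    (fun β : Iio α => iteratedDerivedSet (univ : Set X) β)
    (fun β => isClosed_iteratedDerivedSet_univ β.1) hdisj
    (Antitone.directed_ge fun _ _ h => iteratedDerivedSet_antitone univ h)
  exact ⟨β, β.2, disjoint_iff_inter_eq_empty.2 hβ⟩

/-- Finiteness carries both steps. At successors, closure commutes with the finite union. At limits,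
a fibre missing the intersection already misses an earlier derived set, and finitely many such
stages have a supremum below the limit. -/
lemma iteratedDerivedSet_subset_iUnion_image [CompactSpace X] [T2Space X] {F : Set C(X, X)}
    (hfin : F.Finite) (hcov : ⋃ f ∈ F, range f = univ) (α : Ordinal) :
    iteratedDerivedSet (univ : Set X) α ⊆ ⋃ f ∈ F, f '' iteratedDerivedSet univ α := by
  induction α using Ordinal.limitRecOn with
  | zero => simp [hcov]
  | add_one α ih =>
    have hcl : ∀ f : C(X, X), derivedSet (f '' iteratedDerivedSet univ α) ⊆
        f '' iteratedDerivedSet univ (α + 1) := fun f => by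
      rw [iteratedDerivedSet_univ_succ]
      exact derivedSet_image_subset f.continuous _
    rw [iteratedDerivedSet_univ_succ (X := X)]
    intro y hy
    have hy' := derivedSet_mono _ _ ih hy
    rw [mem_derivedSet_iff_mem_closure] at hy'
    replace hy' := closure_mono (t := ⋃ f ∈ F, f '' iteratedDerivedSet univ α \ {y})
      (fun x hx => by simpa [hx.2] using hx.1) hy'
    rw [hfin.closure_biUnion] at hy'
    simp only [mem_iUnion, exists_prop] at hy'
    obtain ⟨f, hf, hyf⟩ := hy'
    have := hcl f (mem_derivedSet_iff_mem_closure.2 hyf)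
    rw [iteratedDerivedSet_univ_succ] at this
    exact mem_biUnion hf this
  | limit α hα ih =>
    intro y hy
    by_contra hne
    simp only [mem_iUnion, exists_prop, not_exists, not_and] at hne
    have h1 : ∀ f : C(X, X), ∃ β < α, f ∈ F →
        Disjoint (f ⁻¹' {y}) (iteratedDerivedSet (univ : Set X) β) := fun f => by
      by_cases hf : f ∈ F
      · obtain ⟨β, hβ, hd⟩ := exists_disjoint_iteratedDerivedSet hα
          (isClosed_singleton.preimage f.continuous) (C := f ⁻¹' {y})
          (disjoint_left.2 fun z hz hzα => hne f hf ⟨z, hzα, hz⟩)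
        exact ⟨β, hβ, fun _ => hd⟩
      · exact ⟨0, hα.pos, fun h => (hf h).elim⟩
    choose b hb hbF using h1
    have hlt : hfin.toFinset.sup b < α := (Finset.sup_lt_iff hα.bot_lt).2 fun f _ => hb f
    have hy' := ih _ hlt (iteratedDerivedSet_antitone _ hlt.le hy)
    simp only [mem_iUnion, exists_prop] at hy'
    obtain ⟨f, hf, z, hz, rfl⟩ := hy'
    refine disjoint_left.1 (hbF f hf) rfl (iteratedDerivedSet_antitone _ ?_ hz)
    exact Finset.le_sup (hfin.mem_toFinset.2 hf)

/-- The scattered height of a topological fractal is not a limit ordinal. -/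
lemma IsTopologicalFractal.not_isSuccLimit_scatteredHeight [CompactSpace X] [T2Space X]
    {F : Set C(X, X)} (hF : IsTopologicalFractal F) :
    ¬ Order.IsSuccLimit (scatteredHeight X) := by
  intro hlim
  set l := scatteredHeight X with hl
  let D : Ordinal → Set X := iteratedDerivedSet univ
  have hanti : Antitone D := iteratedDerivedSet_antitone univ
  have hne : {α : Ordinal.{u} | (D α).Finite}.Nonempty := by
    by_contra h
    rw [not_nonempty_iff_eq_empty] at h
    have : l = 0 := by rw [hl, scatteredHeight]; simp only [D] at h; rw [h, Ordinal.sInf_empty]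
    exact hlim.ne_bot this
  have hPfin : (D l).Finite := csInf_mem hne
  have hDinf : ∀ α < l, (D α).Infinite := fun α hα h => notMem_of_lt_csInf' hα h
  obtain ⟨U, hU, hUd⟩ := hPfin.t2_separation
  obtain ⟨n, hn⟩ : ∃ n, ∀ f ∈ iterComp F n, ∃ V ∈ U '' D l ∪ {(D l)ᶜ}, range f ⊆ V := by
    refine hF.contracting _ ?_ ?_
    · rintro _ (⟨p, -, rfl⟩ | rfl)
      · exact (hU p).2
      · exact (isClosed_iteratedDerivedSet_univ l).isOpen_compl
    · refine eq_univ_of_forall fun x => ?_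
      by_cases hx : x ∈ D l
      · exact ⟨U x, Or.inl ⟨x, hx, rfl⟩, (hU x).1⟩
      · exact ⟨_, Or.inr rfl, hx⟩
  -- Passing to n + 1 keeps the block length positive even if n = 0, so that k blocks make a
  -- composition of length at least k.
  replace hn := range_subset_of_iterComp_le n.le_succ hn
  set G := iterComp F (n + 1) with hG
  have hGfin : G.Finite := finite_iterComp hF.finite _
  have hGcov : ⋃ f ∈ G, range f = univ := iterComp_cover hF.cover _
  obtain ⟨α₀, hα₀, hα₀d⟩ := exists_disjoint_iteratedDerivedSet hlim (C := (⋃ p ∈ D l, U p)ᶜ)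
    (isOpen_biUnion fun p _ => (hU p).2).isClosed_compl
    (disjoint_left.2 fun p hp hpl => hp (mem_biUnion hpl (hU p).1))
  have hUeq : ∀ p ∈ D l, ∀ q ∈ D l, ∀ x, x ∈ U p → x ∈ U q → p = q := fun p hp q hq x hxp hxq => by
    by_contra h
    exact disjoint_left.1 (hUd hp hq h) hxp hxq
  -- If f p leaves `D l`, it leaves some `D β`. As p is the only point of `D l` in the closure of `U
  -- p`, compactness gives a stage past which points of `U p` are not sent into `D β`. Irrelevant
  -- pairs get stage 0, so a finite supremum serves all pairs.
  have hbad : ∀ fp : C(X, X) × X, ∃ α < l, fp.2 ∈ D l → fp.1 fp.2 ∉ D l →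
      ∀ z ∈ U fp.2, z ∈ D α → fp.1 z ∉ D α := by
    rintro ⟨f, p⟩
    by_cases hp : p ∈ D l
    swap
    · exact ⟨0, hlim.pos, fun h => (hp h).elim⟩
    by_cases hfp : f p ∈ D l
    · exact ⟨0, hlim.pos, fun _ h => (h hfp).elim⟩
    obtain ⟨β, hβ, hfβ⟩ : ∃ β < l, f p ∉ D β := by
      simp only [D, iteratedDerivedSet_limit hlim] at hfp
      simpa using hfp
    obtain ⟨β', hβ', hd⟩ := exists_disjoint_iteratedDerivedSet hlim
      (C := closure (U p) ∩ f ⁻¹' D β) (isClosed_closure.inter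
        ((isClosed_iteratedDerivedSet_univ β).preimage f.continuous)) (by
        refine disjoint_left.2 fun q hq hql => ?_
        have hqp : q = p := by
          by_contra h
          obtain ⟨x, hx1, hx2⟩ := mem_closure_iff.1 hq.1 (U q) (hU q).2 (hU q).1
          exact h (hUeq q hql p hp x hx1 hx2)
        rw [hqp] at hq
        exact hfβ hq.2)
    refine ⟨max β β', max_lt hβ hβ', fun _ _ z hz hzα hfz => ?_⟩
    exact disjoint_left.1 hd ⟨subset_closure hz, hanti (le_max_left _ _) hfz⟩
      (hanti (le_max_right _ _) hzα)
  choose b hb hbad using hbad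
  let α := max α₀ ((hGfin.prod hPfin).toFinset.sup b)
  have hα : α < l := max_lt hα₀ ((Finset.sup_lt_iff hlim.bot_lt).2 fun f _ => hb f)
  have hgood : ∀ f ∈ G, ∀ p ∈ D l, ∀ z ∈ U p, z ∈ D α → f z ∈ D α → f p ∈ D l := by
    intro f hf p hp z hz hzα hfz
    by_contra hfp
    have hle : b (f, p) ≤ α := le_trans
      (Finset.le_sup (f := b) ((hGfin.prod hPfin).mem_toFinset.2 ⟨hf, hp⟩)) (le_max_right _ _)
    exact hbad (f, p) hp hfp z hz (hanti hle hzα) (hanti hle hfz)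
  have hcell : ∀ z ∈ D α, ∃ p ∈ D l, z ∈ U p := fun z hz => by
    by_contra h
    exact disjoint_left.1 hα₀d (by simpa using h) (hanti (le_max_left _ _) hz)
  -- Write y = f z with z in `D α`; by the choice of α, z is not in `D l`, and its companion p
  -- satisfies f p ∈ `D l`. The range of f then lies in a single neighbourhood, which forces f p =
  -- q.
  have key : ∀ k, ∀ q ∈ D l, ∀ y ∈ U q, y ∈ D α → y ∉ D l →
      ∃ h ∈ iterComp G k, y ∈ range h ∧ q ∈ range h := by
    intro k
    induction k with
    | zero => exact fun q _ y _ _ _ => ⟨_, rfl, ⟨y, rfl⟩, ⟨q, rfl⟩⟩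
    | succ k ih =>
      intro q hq y hyq hyα hyl
      have hy := iteratedDerivedSet_subset_iUnion_image hGfin hGcov α hyα
      simp only [mem_iUnion, exists_prop] at hy
      obtain ⟨f, hf, z, hzα, rfl⟩ := hy
      have hzl : z ∉ D l := fun h => hyl (hgood f hf z h z (hU z).1 hzα hyα)
      obtain ⟨p, hp, hzp⟩ := hcell z hzα
      obtain ⟨g, hg, ⟨z', hz'⟩, ⟨p', hp'⟩⟩ := ih p hp z hzp hzα hzl
      have hfp : f p ∈ D l := hgood f hf p hp z hzp hzα hyα
      refine ⟨f.comp g, ⟨f, hf, g, hg, rfl⟩, ⟨z', by simp [hz']⟩, ⟨p', ?_⟩⟩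
      rw [ContinuousMap.comp_apply, hp']
      obtain ⟨V, ⟨q', hq', rfl⟩ | rfl, hV⟩ := hn f hf
      · rw [hUeq q hq q' hq' _ hyq (hV (mem_range_self z))]
        exact hUeq _ hfp q' hq' _ (hU _).1 (hV (mem_range_self p))
      · exact (hV (mem_range_self p) hfp).elim
  obtain ⟨y, hyα, hyl⟩ := ((hDinf α hα).sdiff hPfin).nonempty
  obtain ⟨q, hq, hyq⟩ := hcell y hyα
  have hyq' : y ≠ q := fun h => hyl (h ▸ hq)
  obtain ⟨m, hm⟩ := hF.contracting {{y}ᶜ, {q}ᶜ} (by simp) (by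
    refine eq_univ_of_forall fun x => ?_
    by_cases hx : x = y
    · exact ⟨_, Or.inr rfl, fun h => hyq' (hx.symm.trans h)⟩
    · exact ⟨_, Or.inl rfl, hx⟩)
  replace hm := range_subset_of_iterComp_le (n := m * (n + 1)) (by nlinarith) hm
  obtain ⟨h, hh, hy, hq⟩ := key m q hq y hyq hyα hyl
  obtain ⟨V, rfl | rfl, hV⟩ := hm h (iterComp_iterComp_subset _ _ hh)
  · exact hV hy rfl
  · exact hV hq rfl

end Derived

end FractalThm

/-! ### Shift-invariant coding of uncountable spaces -/

namespace FractalThm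

open Set PiNat

section Splice

lemma splice_of_lt {n k : ℕ} (h : k < n) (a : Word) (d : Fin 3) (u : Word) :
    splice n a d u k = a k := if_pos h

@[simp] lemma splice_self (n : ℕ) (a : Word) (d : Fin 3) (u : Word) : splice n a d u n = d := by
  simp [splice]

@[simp] lemma splice_add (n k : ℕ) (a : Word) (d : Fin 3) (u : Word) :
    splice n a d u (n + 1 + k) = u k := by
  simp only [splice]
  rw [if_neg (by omega), if_neg (by omega)]
  congr 1
  omega

lemma splice_injective (n : ℕ) (a : Word) (d : Fin 3) {u v : Word}
    (h : splice n a d u = splice n a d v) : u = v := by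
  funext k
  simpa using congrFun h (n + 1 + k)

lemma tail_splice_zero (a : Word) (d : Fin 3) (u : Word) : tail (splice 0 a d u) = u := by
  funext k
  simpa [tail, add_comm] using splice_add 0 k a d u

lemma tail_splice_succ (n : ℕ) (a : Word) (d : Fin 3) (u : Word) :
    tail (splice (n + 1) a d u) = splice n (tail a) d u := by
  funext k
  simp only [tail, splice, Nat.add_lt_add_iff_right, Nat.add_right_cancel_iff]
  congr 3
  omega

lemma splice_congr {n : ℕ} {a b : Word} (h : ∀ i < n, a i = b i) (d : Fin 3) (u : Word) :
    splice n a d u = splice n b d u := by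
  funext k
  by_cases hk : k < n
  · rw [splice_of_lt hk, splice_of_lt hk, h k hk]
  · simp only [splice, if_neg hk]

lemma continuous_splice (n : ℕ) (a : Word) (d : Fin 3) : Continuous (splice n a d) := by
  refine continuous_pi fun k => ?_
  unfold splice
  split_ifs
  · exact continuous_const
  · exact continuous_const
  · exact continuous_apply _

end Splice

section CantorCode

/-- A binary sequence, viewed as a word over three letters. -/
def binaryWord (p : ℕ → Bool) : Word := fun k => if p k then 1 else 0

lemma binaryWord_ne_two (p : ℕ → Bool) (k : ℕ) : binaryWord p k ≠ 2 := by
  unfold binaryWord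
  split_ifs <;> decide

lemma binaryWord_apply_inj {p q : ℕ → Bool} {k l : ℕ} :
    binaryWord p k = binaryWord q l ↔ p k = q l := by
  unfold binaryWord
  cases p k <;> cases q l <;> simp

lemma binaryWord_injective : Function.Injective binaryWord := fun p q h => by
  funext k
  exact binaryWord_apply_inj.1 (congrFun h k)

lemma continuous_binaryWord : Continuous binaryWord :=
  continuous_pi fun k => (continuous_of_discreteTopology (f := fun b : Bool =>
    (if b then 1 else 0 : Fin 3))).comp (continuous_apply k)

lemma not_countable_nat_bool : ¬ Countable (ℕ → Bool) := fun _ => by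
  obtain ⟨t, ht⟩ := exists_surjective_nat (ℕ → Bool)
  obtain ⟨m, hm⟩ := ht fun k => !t k k
  simpa using congrFun hm m

/-- The Cantor set is homeomorphic to its square. -/
def interleave : (ℕ → Bool) × (ℕ → Bool) ≃ₜ (ℕ → Bool) :=
  Homeomorph.sumArrowHomeomorphProdArrow.symm.trans
    (Homeomorph.piCongrLeft (Y := fun _ => Bool) Equiv.natSumNatEquivNat)

/-- Embeddings of the square of the Cantor set into the Cantor set with decreasing images. -/
def spread : ℕ → (ℕ → Bool) × (ℕ → Bool) → ℕ → Bool
  | 0, v => interleave v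
  | n + 1, v => spread n (interleave v, fun _ => false)

lemma continuous_spread : ∀ n, Continuous (spread n)
  | 0 => interleave.continuous
  | n + 1 => (continuous_spread n).comp (interleave.continuous.prodMk continuous_const)

lemma spread_injective : ∀ n, Function.Injective (spread n)
  | 0 => interleave.injective
  | n + 1 => fun _ _ h => interleave.injective (congrArg Prod.fst (spread_injective n h))

variable {A : Type u} [TopologicalSpace A] [CompactSpace A] [T2Space A]
  [SecondCountableTopology A] [TotallyDisconnectedSpace A]

/-- A closed set in a zero-dimensional compact metrizable space is the zero set of a continuous
map to the Cantor set that separates all other points. -/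
lemma exists_cantor_map_collapsing {C : Set A} (hC : IsClosed C) :
    ∃ j : A → ℕ → Bool, Continuous j ∧ (∀ x ∈ C, j x = fun _ => false) ∧
      (∀ x ∉ C, j x ≠ fun _ => false) ∧ ∀ x ∉ C, ∀ y, j x = j y → x = y := by
  classical
  have hcount : Countable (TopologicalSpace.Clopens A) :=
    TopologicalSpace.Clopens.countable_iff_secondCountable.2 inferInstance
  -- The coordinates of `j` are the indicators of the countably many clopen sets disjoint from C.
  let T := {V : TopologicalSpace.Clopens A // Disjoint (V : Set A) C}
  have : Nonempty T := ⟨⟨⊥, by simp⟩⟩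
  obtain ⟨V, hV⟩ := exists_surjective_nat T
  let j : A → ℕ → Bool := fun x n => decide (x ∈ (V n).1)
  have hsep : ∀ x ∉ C, ∀ W : Set A, IsOpen W → x ∈ W → ∃ n, j x n = true ∧
      ∀ y ∉ W, j y n = false := fun x hx W hW hxW => by
    obtain ⟨B, hB, hxB, hBW⟩ := compact_exists_isClopen_in_isOpen (hW.inter hC.isOpen_compl)
      ⟨hxW, hx⟩
    obtain ⟨n, hn⟩ := hV ⟨⟨B, hB⟩, disjoint_left.2 fun y hy => (hBW hy).2⟩
    refine ⟨n, by simpa [j, hn] using hxB, fun y hy => ?_⟩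
    simp only [j, hn, decide_eq_false_iff_not]
    exact fun h => hy (hBW h).1
  refine ⟨j, continuous_pi fun n => ?_, fun x hx => ?_, fun x hx h => ?_, fun x hx y hxy => ?_⟩
  · refine continuous_discrete_rng.2 fun b => ?_
    cases b
    · convert (V n).1.isClopen.compl.isOpen using 1
      ext x; simp [j]
    · convert (V n).1.isClopen.isOpen using 1
      ext x; simp [j]
  · funext n
    simpa [j] using fun h => disjoint_left.1 (V n).2 h hx
  · obtain ⟨n, hn, -⟩ := hsep x hx univ isOpen_univ trivial
    simp [h] at hn
  · by_contra hne
    obtain ⟨n, hn, hn'⟩ := hsep x hx {y}ᶜ isOpen_compl_singleton hne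
    have := hn' y (by simp)
    rw [← hxy, hn] at this
    exact absurd this (by simp)

/-- An uncountable zero-dimensional compact metrizable space embeds into the square of the
Cantor set with image containing a horizontal section. -/
lemma exists_cantor_sq_embedding (hA : Uncountable A) :
    ∃ g : A → (ℕ → Bool) × (ℕ → Bool), Continuous g ∧ Function.Injective g ∧
      ∀ p, ∃ x, g x = (p, fun _ => false) := by
  let := TopologicalSpace.metrizableSpaceMetric A
  obtain ⟨f, -, hf, hfi⟩ := (isClosed_univ (X := A)).exists_nat_bool_injection_of_not_countable
    (by rwa [countable_univ_iff, not_countable_iff])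
  obtain ⟨j, hj, -, -, hji⟩ := exists_cantor_map_collapsing (A := A) isClosed_empty
  have hjinj : Function.Injective j := fun x y h => hji x (by simp) y h
  have hcl := (hj.comp hf).isClosedEmbedding (hjinj.comp hfi)
  obtain ⟨s, hs1, hs2, hs3⟩ := exists_retraction_of_isClosed hcl.isClosed_range (range_nonempty _)
  have hmem : ∀ x, ∃ p, (j ∘ f) p = s (j x) := fun x => by
    have : s (j x) ∈ range s := mem_range_self _
    rwa [hs2] at this
  choose r hr using hmem
  have hrc : Continuous r := by
    rw [hcl.isInducing.continuous_iff]
    convert hs3.comp hj using 1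
    funext x; exact hr x
  have hrf : ∀ p, r (f p) = p := fun p => by
    apply hcl.injective
    rw [hr]
    exact hs1 _ (mem_range_self p)
  -- The map `r` retracts onto the Cantor set `range f`. Adding `c`, which is zero exactly there and
  -- separates all other points, makes the pair injective.
  obtain ⟨c, hc, hc0, hc1, hci⟩ := exists_cantor_map_collapsing (A := A)
    (isCompact_range hf).isClosed
  refine ⟨fun x => (r x, c x), hrc.prodMk hc, fun x y hxy => ?_, fun p => ⟨f p, ?_⟩⟩
  · simp only [Prod.mk.injEq] at hxy
    by_cases hx : x ∈ range f
    · by_cases hy : y ∈ range f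
      · obtain ⟨p, rfl⟩ := hx
        obtain ⟨q, rfl⟩ := hy
        rw [hrf, hrf] at hxy
        rw [hxy.1]
      · exact (hci y hy x hxy.2.symm).symm
    · exact hci x hx y hxy.2
  · simp only [hrf, hc0 _ (mem_range_self p)]

/-- The hypotheses stand behind the existential quantifier so that one embedding can be chosen per
set. Sets given by different words with the same prefix then share it. -/
lemma exists_cantor_sq_embedding_on (V : Set A) : ∃ g : A → (ℕ → Bool) × (ℕ → Bool),
    IsClopen V → ¬ V.Countable → ContinuousOn g V ∧ InjOn g V ∧
      ∀ p, ∃ x ∈ V, g x = (p, fun _ => false) := by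
  classical
  by_cases hV : IsClopen V ∧ ¬ V.Countable
  swap
  · exact ⟨fun _ => Classical.arbitrary _, fun h1 h2 => (hV ⟨h1, h2⟩).elim⟩
  have := isCompact_iff_compactSpace.1 hV.1.isClosed.isCompact
  obtain ⟨g, hg, hgi, hgs⟩ := exists_cantor_sq_embedding (A := V)
    (by rw [← not_countable_iff]; exact hV.2)
  refine ⟨fun x => if hx : x ∈ V then g ⟨x, hx⟩ else Classical.arbitrary _, fun _ _ =>
    ⟨?_, fun x hx y hy h => ?_, fun p => ?_⟩⟩
  · rw [continuousOn_iff_continuous_domRestrict]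
    convert hg using 1
    funext x; simp
  · simp only [dif_pos hx, dif_pos hy] at h
    exact congrArg Subtype.val (hgi h)
  · obtain ⟨x, hx⟩ := hgs p
    exact ⟨x, x.2, by simpa using hx⟩

/-- An uncountable zero-dimensional compact metrizable space is homeomorphic to a shift-invariant
set of words. -/
lemma exists_shift_code_of_uncountable (hA : Uncountable A) :
    ∃ e : A → Word, Continuous e ∧ Function.Injective e ∧ ∀ x, tail (e x) ∈ range e := by
  classical
  obtain ⟨g, hg, hgi, hgs⟩ := exists_cantor_sq_embedding hA
  choose E hE using exists_cantor_sq_embedding_on (A := A)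
  let a : A → ℕ → Bool := fun x => (interleave.symm (g x).1).1
  let b : A → ℕ → Bool := fun x => (interleave.symm (g x).1).2
  let c : A → ℕ → Bool := fun x => (g x).2
  have ha : Continuous a := by fun_prop
  have hb : Continuous b := by fun_prop
  have hc : Continuous c := by fun_prop
  have hinj : ∀ x y, a x = a y → b x = b y → c x = c y → x = y := fun x y h1 h2 h3 =>
    hgi (Prod.ext (interleave.symm.injective (Prod.ext h1 h2)) h3)
  have hex : ∀ p q, ∃ x, a x = p ∧ b x = q ∧ c x = fun _ => false := fun p q => by
    obtain ⟨x, hx⟩ := hgs (interleave (p, q))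
    exact ⟨x, by simp [a, hx], by simp [b, hx], by simp [c, hx]⟩
  let d : A → ℕ → Bool := fun x n => b x n || c x n
  have hd : ∀ n, Continuous fun x => d x n := fun n =>
    (continuous_of_discreteTopology (f := fun t : Bool × Bool => t.1 || t.2)).comp
      (((continuous_apply n).comp hb).prodMk ((continuous_apply n).comp hc))
  have hclo : ∀ {f : A → Bool}, Continuous f → ∀ t, IsClopen {x | f x = t} := fun hf t =>
    (isClopen_discrete {t}).preimage hf
  -- These pieces partition the points with `d` ≠ 0 by the first position n where `d` is true and
  -- the first n letters of `a`. They are uncountable because `b` is free after position n.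
  let V : ℕ → (ℕ → Bool) → Set A := fun n p =>
    {x | (∀ i < n, a x i = p i) ∧ (∀ i < n, d x i = false) ∧ d x n = true}
  have hVclo : ∀ n p, IsClopen (V n p) := fun n p => by
    have h1 : V n p = (⋂ i ∈ Finset.range n, {x | a x i = p i}) ∩
        ((⋂ i ∈ Finset.range n, {x | d x i = false}) ∩ {x | d x n = true}) := by
      ext x; simp [V]
    rw [h1]
    exact (isClopen_biInter_finset fun i _ => hclo ((continuous_apply i).comp ha) _).inter
      ((isClopen_biInter_finset fun i _ => hclo (hd i) _).inter (hclo (hd n) _))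
  have hVunc : ∀ n p, ¬ (V n p).Countable := fun n p hcount => by
    choose s hs1 hs2 hs3 using fun q : ℕ → Bool =>
      hex p (fun i => if i < n then false else if i = n then true else q (i - n - 1))
    have hsi : Function.Injective s := fun q r h => by
      have h2 := hs2 q
      rw [h, hs2 r] at h2
      funext i
      have h3 := congrFun h2 (n + 1 + i)
      simp only [if_neg (show ¬ n + 1 + i < n by omega), if_neg (show n + 1 + i ≠ n by omega),
        show n + 1 + i - n - 1 = i by omega] at h3
      exact h3.symm
    have hsV : ∀ q, s q ∈ V n p := fun q => by
      refine ⟨fun i _ => by rw [hs1], fun i hi => ?_, ?_⟩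
      · simp [d, hs2, hs3, hi]
      · simp [d, hs2, hs3]
    have := (hcount.mono (range_subset_iff.2 hsV)).to_subtype
    have hct : Countable (ℕ → Bool) := Countable.of_equiv _ (Equiv.ofInjective s hsi).symm
    exact not_countable_nat_bool hct
  have hVcongr : ∀ n p q, (∀ i < n, p i = q i) → V n p = V n q := fun n p q h => by
    ext x
    refine and_congr_left fun _ => forall₂_congr fun i hi => by rw [h i hi]
  -- The unique letter 2 marks n, and the prefix then determines the piece. Near a point with `d` =
  -- 0 the 2 occurs arbitrarily late, which gives continuity there.
  let e : A → Word := fun x => if h : ∃ n, d x n = true then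
    splice (Nat.find h) (binaryWord (a x)) 2
      (binaryWord (spread (Nat.find h) (E (V (Nat.find h) (a x)) x))) else binaryWord (a x)
  have heV : ∀ {n p x}, x ∈ V n p →
      e x = splice n (binaryWord p) 2 (binaryWord (spread n (E (V n p) x))) := by
    intro n p x hx
    have h : ∃ n, d x n = true := ⟨n, hx.2.2⟩
    have hn : Nat.find h = n := by
      rw [Nat.find_eq_iff]
      exact ⟨hx.2.2, fun m hm => by simp [hx.2.1 m hm]⟩
    simp only [e, dif_pos h, hn]
    rw [hVcongr n (a x) p hx.1]
    exact splice_congr (fun i hi => binaryWord_apply_inj.2 (hx.1 i hi)) _ _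
  have he0 : ∀ {x}, (∀ n, d x n = false) → e x = binaryWord (a x) := fun {x} hx =>
    dif_neg (by simp [hx])
  have hcases : ∀ x, (∀ n, d x n = false) ∨ ∃ n, x ∈ V n (a x) := fun x => by
    by_cases h : ∃ n, d x n = true
    · refine Or.inr ⟨Nat.find h, fun _ _ => rfl, fun i hi => ?_, Nat.find_spec h⟩
      simpa using Nat.find_min h hi
    · exact Or.inl (by simpa using h)
  have heV2 : ∀ {n p x}, x ∈ V n p → e x n = 2 := fun hx => by rw [heV hx, splice_self]
  have heV1 : ∀ {n p x i}, x ∈ V n p → i < n → e x i = binaryWord (a x) i := fun {n p x i} hx hi => by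
    rw [heV hx, splice_of_lt hi]
    exact (binaryWord_apply_inj.2 (hx.1 i hi)).symm
  have hlt : ∀ {x i}, (∀ k ≤ i, d x k = false) → e x i = binaryWord (a x) i := fun {x i} h => by
    rcases hcases x with h' | ⟨n, hn⟩
    · rw [he0 h']
    · refine heV1 hn ?_
      by_contra hni
      have := h n (not_lt.1 hni)
      rw [hn.2.2] at this
      exact absurd this (by simp)
  refine ⟨e, continuous_of_mem_cylinder fun x k => ?_, fun x y hxy => ?_, fun x => ?_⟩
  · rcases hcases x with h | ⟨n, hn⟩
    · have h1 : ∀ i, ∀ᶠ y in 𝓝 x, d y i = false ∧ a y i = a x i := fun i =>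
        Filter.Eventually.and ((hclo (hd i) false).isOpen.mem_nhds (h i))
          ((hclo ((continuous_apply i).comp ha) (a x i)).isOpen.mem_nhds rfl)
      filter_upwards [(Finset.range k).eventually_all.2 fun i _ => h1 i] with y hy
      intro i hi
      rw [he0 h, hlt fun j hj => (hy j (Finset.mem_range.2 (by omega))).1]
      exact binaryWord_apply_inj.2 (hy i (Finset.mem_range.2 hi)).2
    · have hcont : ContinuousOn e (V n (a x)) := by
        refine ContinuousOn.congr (f := fun y => splice n (binaryWord (a x)) 2
          (binaryWord (spread n (E (V n (a x)) y)))) ?_ fun y hy => heV hy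
        exact ((continuous_splice _ _ _).comp
          (continuous_binaryWord.comp (continuous_spread n))).comp_continuousOn
            (hE _ (hVclo n _) (hVunc n _)).1
      exact (hcont.continuousAt ((hVclo n _).isOpen.mem_nhds hn)).eventually
        ((isOpen_cylinder _ (e x) k).mem_nhds (self_mem_cylinder _ _))
  · rcases hcases x with hx | ⟨n, hn⟩
    · rcases hcases y with hy | ⟨m, hm⟩
      · rw [he0 hx, he0 hy] at hxy
        have hz : ∀ {z}, (∀ n, d z n = false) → b z = (fun _ => false) ∧ c z = fun _ => false := by
          intro z hz
          simp only [d, Bool.or_eq_false_iff] at hz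
          exact ⟨funext fun n => (hz n).1, funext fun n => (hz n).2⟩
        exact hinj x y (binaryWord_injective hxy) ((hz hx).1.trans (hz hy).1.symm)
          ((hz hx).2.trans (hz hy).2.symm)
      · have := heV2 hm
        rw [← hxy, he0 hx] at this
        exact absurd this (binaryWord_ne_two _ _)
    · rcases hcases y with hy | ⟨m, hm⟩
      · have := heV2 hn
        rw [hxy, he0 hy] at this
        exact absurd this (binaryWord_ne_two _ _)
      · have hnm : n = m := by
          rcases lt_trichotomy n m with h | h | h
          · have h2 := heV2 hn
            rw [hxy, heV1 hm h] at h2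
            exact absurd h2 (binaryWord_ne_two _ _)
          · exact h
          · have h2 := heV2 hm
            rw [← hxy, heV1 hn h] at h2
            exact absurd h2 (binaryWord_ne_two _ _)
        subst hnm
        have hm' : y ∈ V n (a x) := by
          rw [hVcongr n (a x) (a y)]
          · exact hm
          · intro i hi
            rw [← binaryWord_apply_inj, ← heV1 hn hi, ← heV1 hm hi, hxy]
        rw [heV hn, heV hm'] at hxy
        exact (hE _ (hVclo n _) (hVunc n _)).2.1 hn hm'
          (spread_injective n (binaryWord_injective (splice_injective _ _ _ hxy)))
  · have hbin : ∀ p, binaryWord p ∈ range e := fun p => by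
      obtain ⟨y, hy1, hy2, hy3⟩ := hex p fun _ => false
      exact ⟨y, by rw [he0 (by simp [d, hy2, hy3]), hy1]⟩
    rcases hcases x with hx | ⟨n, hn⟩
    · rw [he0 hx]
      exact hbin fun k => a x (k + 1)
    · rw [heV hn]
      cases n with
      | zero => rw [tail_splice_zero]; exact hbin _
      | succ n =>
        rw [tail_splice_succ]
        -- Shifting moves the 2 from n + 1 to n and keeps the suffix. By definition `spread (n + 1)
        -- v` is `spread n` at a point of the horizontal section, and every embedding `E` attains
        -- that section.
        obtain ⟨y, hy, hyE⟩ := (hE _ (hVclo n fun k => a x (k + 1)) (hVunc n _)).2.2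
          (interleave (E (V (n + 1) (a x)) x))
        refine ⟨y, ?_⟩
        rw [heV hy, hyE]
        rfl

end CantorCode

end FractalThm

/-! ### Standard sets of words for countable spaces -/

namespace FractalThm

open Set PiNat

section RankedWords

/-- `α` is the largest among `e 0, …, e n` that lies below `δ`. -/
def IsTopBelow (e : ℕ → Ordinal.{u}) (δ : Ordinal.{u}) (n : ℕ) (α : Ordinal.{u}) : Prop :=
  (∃ i ≤ n, e i = α) ∧ α < δ ∧ ∀ i ≤ n, e i < δ → e i ≤ α

/-- The standard set of words of rank `δ`: the zero word, together with the words
`0...01x` with `n` leading zeros in which `x` belongs to the standard set of the largest rank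
among `e 0, …, e n` below `δ`. -/
inductive RankedWord (e : ℕ → Ordinal.{u}) : Ordinal.{u} → Word → Prop
  | zero (δ : Ordinal.{u}) : RankedWord e δ 0
  | branch (δ : Ordinal.{u}) (n : ℕ) (α : Ordinal.{u}) (x : Word) :
      IsTopBelow e δ n α → RankedWord e α x → RankedWord e δ (splice n 0 1 x)

variable {e : ℕ → Ordinal.{u}}

lemma exists_isTopBelow {δ : Ordinal.{u}} {n i : ℕ} (hi : i ≤ n) (h : e i < δ) :
    ∃ α, IsTopBelow e δ n α := by
  classical
  obtain ⟨j, hj, hmax⟩ := ((Finset.range (n + 1)).filter fun i => e i < δ).exists_max_image e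
    ⟨i, by simp [h]; omega⟩
  simp only [Finset.mem_filter, Finset.mem_range] at hj hmax
  exact ⟨e j, ⟨j, by omega, rfl⟩, hj.2, fun k hk hkδ => hmax k ⟨by omega, hkδ⟩⟩

lemma IsTopBelow.unique {δ α β : Ordinal.{u}} {n : ℕ} (hα : IsTopBelow e δ n α)
    (hβ : IsTopBelow e δ n β) : α = β := by
  obtain ⟨⟨i, hi, rfl⟩, hi', hi''⟩ := hα
  obtain ⟨⟨j, hj, rfl⟩, hj', hj''⟩ := hβ
  exact le_antisymm (hj'' i hi hi') (hi'' j hj hj')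

lemma RankedWord.mono {δ : Ordinal.{u}} {x : Word} (h : RankedWord e δ x) :
    ∀ {γ : Ordinal.{u}}, δ ≤ γ → RankedWord e γ x := by
  induction h with
  | zero => exact fun _ => .zero _
  | branch δ n α x hα _ ih =>
    intro γ hγ
    obtain ⟨⟨i, hi, rfl⟩, hlt, -⟩ := hα
    obtain ⟨β, hβ⟩ := exists_isTopBelow hi (hlt.trans_le hγ)
    exact .branch γ n β x hβ (ih (hβ.2.2 i hi (hlt.trans_le hγ)))

/-- Deleting a leading 0 lowers n, which is harmless when the prescribed rank at n + 1 is already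
the one at n. Deleting the 1 leaves a word of smaller rank, covered by `RankedWord.mono`. -/
lemma RankedWord.tail {δ : Ordinal.{u}}
    (hδ : ∀ n α, IsTopBelow e δ (n + 1) α → IsTopBelow e δ n α) {x : Word}
    (h : RankedWord e δ x) : RankedWord e δ (tail x) := by
  cases h with
  | zero => exact .zero _
  | branch _ n α x hα hx =>
    cases n with
    | zero => rw [tail_splice_zero]; exact hx.mono hα.2.1.le
    | succ n => rw [tail_splice_succ]; exact .branch _ _ _ _ (hδ n α hα) hx

/-- The words `2...2x` with at most `m` leading twos and `x` in the standard set of rank `δ`. -/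
def multiRankedWord (e : ℕ → Ordinal.{u}) (δ : Ordinal.{u}) : ℕ → Set Word
  | 0 => {x | RankedWord e δ x}
  | m + 1 => {x | RankedWord e δ x} ∪ cons 2 '' multiRankedWord e δ m

lemma multiRankedWord_subset_succ {δ : Ordinal.{u}} :
    ∀ m, multiRankedWord e δ m ⊆ multiRankedWord e δ (m + 1)
  | 0 => subset_union_left
  | m + 1 => union_subset_union_right _ (image_mono (multiRankedWord_subset_succ m))

lemma tail_mem_multiRankedWord {δ : Ordinal.{u}}
    (hδ : ∀ n α, IsTopBelow e δ (n + 1) α → IsTopBelow e δ n α) :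
    ∀ m, ∀ x ∈ multiRankedWord e δ m, tail x ∈ multiRankedWord e δ m
  | 0, _, hx => RankedWord.tail hδ hx
  | m + 1, x, hx => by
    rcases hx with hx | ⟨y, hy, rfl⟩
    · exact Or.inl (RankedWord.tail hδ hx)
    · rw [tail_cons]; exact multiRankedWord_subset_succ m hy

lemma RankedWord.apply_ne_two {δ : Ordinal.{u}} {x : Word} (h : RankedWord e δ x) : x 0 ≠ 2 := by
  cases h with
  | zero => simp
  | branch _ n α x hα hx => cases n <;> simp [splice]

end RankedWords

section RankedSpaces

variable {X : Type u} [TopologicalSpace X]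

/-- A rank function on a space: every point is the only point of the largest rank in small clopen
neighbourhoods, and all smaller ranks occur near it. -/
structure IsRankFunction (rk : X → Ordinal.{u}) : Prop where
  exists_clopen : ∀ x, ∀ O : Set X, IsOpen O → x ∈ O →
    ∃ V ⊆ O, IsClopen V ∧ x ∈ V ∧ ∀ z ∈ V, z ≠ x → rk z < rk x
  exists_rank_eq : ∀ x, ∀ O : Set X, IsOpen O → x ∈ O → ∀ α < rk x, ∃ z ∈ O, rk z = α

variable {rk : X → Ordinal.{u}}

/-- One step of the exhaustion: V has a single top point, of the prescribed rank α, and swallows the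
target t if its rank allows. A t of rank α serves as the top point; one of smaller rank is absorbed
by adding a neighbourhood. -/
lemma IsRankFunction.exists_clopen_rank_eq [T1Space X] (hrk : IsRankFunction rk) {R : Set X}
    (hR : IsClopen R) {y : X} (hy : y ∈ R) {α : Ordinal.{u}} (hα : α < rk y) (t : X) :
    ∃ V ⊆ R, IsClopen V ∧ y ∉ V ∧ (∃ v ∈ V, rk v = α ∧ ∀ z ∈ V, z ≠ v → rk z < α) ∧
      (t ∈ R → t ≠ y → rk t ≤ α → t ∈ V) := by
  have hopen : IsOpen (R ∩ {y}ᶜ) := hR.isOpen.inter isOpen_compl_singleton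
  by_cases ht : t ∈ R ∧ t ≠ y ∧ rk t = α
  · obtain ⟨V, hVR, hV, htV, hlt⟩ := hrk.exists_clopen t (R ∩ {y}ᶜ) hopen ⟨ht.1, ht.2.1⟩
    exact ⟨V, fun z hz => (hVR hz).1, hV, fun h => (hVR h).2 rfl,
      ⟨t, htV, ht.2.2, by rwa [ht.2.2] at hlt⟩, fun _ _ _ => htV⟩
  obtain ⟨v, hvR, hvα⟩ := hrk.exists_rank_eq y R hR.isOpen hy α hα
  have hvy : v ≠ y := fun h => hα.ne (by rw [← hvα, h])
  obtain ⟨V, hVR, hV, hvV, hlt⟩ := hrk.exists_clopen v (R ∩ {y}ᶜ) hopen ⟨hvR, hvy⟩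
  rw [hvα] at hlt
  by_cases ht' : t ∈ R ∧ t ≠ y ∧ rk t < α
  · obtain ⟨V', hVR', hV', htV', hlt'⟩ := hrk.exists_clopen t (R ∩ {y}ᶜ) hopen ⟨ht'.1, ht'.2.1⟩
    refine ⟨V ∪ V', union_subset (fun z hz => (hVR hz).1) fun z hz => (hVR' hz).1, hV.union hV',
      ?_, ⟨v, Or.inl hvV, hvα, ?_⟩, fun _ _ _ => Or.inr htV'⟩
    · rintro (h | h)
      · exact (hVR h).2 rfl
      · exact (hVR' h).2 rfl
    · rintro z (hz | hz) hzv
      · exact hlt z hz hzv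
      · rcases eq_or_ne z t with rfl | hzt
        · exact ht'.2.2
        · exact (hlt' z hz hzt).trans ht'.2.2
  · refine ⟨V, fun z hz => (hVR hz).1, hV, fun h => (hVR h).2 rfl, ⟨v, hvV, hvα, hlt⟩,
      fun h1 h2 h3 => ?_⟩
    rcases h3.lt_or_eq with h | h
    · exact (ht' ⟨h1, h2, h⟩).elim
    · exact (ht ⟨h1, h2, h⟩).elim

variable {e : ℕ → Ordinal.{u}}

/-- A clopen set with a single point of maximal rank `δ` can be exhausted, up to that point, by
clopen pieces of the ranks prescribed by the enumeration `e`. -/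
lemma IsRankFunction.exists_exhaustion [T1Space X] [Countable X] (hrk : IsRankFunction rk)
    (he : ∀ x, ∃ i, e i = rk x) {Y : Set X} (hY : IsClopen Y) {y : X} (hy : y ∈ Y)
    (hlt : ∀ z ∈ Y, z ≠ y → rk z < rk y) :
    ∃ W : ℕ → Set X, (∀ n, IsClopen (W n)) ∧ (∀ n, W n ⊆ Y) ∧ (∀ n, y ∉ W n) ∧ W 0 = ∅ ∧
      Monotone W ∧ (∀ x ∈ Y, x ≠ y → ∃ n, x ∈ W (n + 1)) ∧
      ∀ n, ((¬ ∃ α, IsTopBelow e (rk y) n α) → W (n + 1) = W n) ∧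
        ∀ α, IsTopBelow e (rk y) n α → ∃ v ∈ W (n + 1) \ W n, rk v = α ∧
          ∀ z ∈ W (n + 1) \ W n, z ≠ v → rk z < α := by
  have : Nonempty X := ⟨y⟩
  obtain ⟨u, hu⟩ := exists_surjective_nat X
  let S := {W : Set X // IsClopen W ∧ W ⊆ Y ∧ y ∉ W}
  have hstep : ∀ (n : ℕ) (W : S), ∃ W' : S, W.1 ⊆ W'.1 ∧
      ((¬ ∃ α, IsTopBelow e (rk y) n α) → W'.1 = W.1) ∧
      (∀ α, IsTopBelow e (rk y) n α → (∃ v ∈ W'.1 \ W.1, rk v = α ∧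
          ∀ z ∈ W'.1 \ W.1, z ≠ v → rk z < α) ∧
        (u n.unpair.1 ∈ Y → u n.unpair.1 ≠ y → rk (u n.unpair.1) ≤ α → u n.unpair.1 ∈ W'.1)) := by
    rintro n ⟨W, hW, hWY, hyW⟩
    by_cases h : ∃ α, IsTopBelow e (rk y) n α
    · obtain ⟨α, hα⟩ := h
      obtain ⟨V, hVR, hV, hyV, hv, ht⟩ := hrk.exists_clopen_rank_eq (hY.diff hW) ⟨hy, hyW⟩
        hα.2.1 (u n.unpair.1)
      refine ⟨⟨W ∪ V, hW.union hV, union_subset hWY fun z hz => (hVR hz).1, ?_⟩,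
        subset_union_left, fun h' => (h' ⟨α, hα⟩).elim, fun β hβ => ?_⟩
      · rintro (h | h)
        · exact hyW h
        · exact hyV h
      · rw [hβ.unique hα]
        have hdiff : (W ∪ V) \ W = V := by
          ext z
          constructor
          · rintro ⟨h1 | h1, h2⟩
            · exact (h2 h1).elim
            · exact h1
          · exact fun hz => ⟨Or.inr hz, (hVR hz).2⟩
        refine ⟨by rwa [hdiff], fun h1 h2 h3 => ?_⟩
        by_cases h4 : u n.unpair.1 ∈ W
        · exact Or.inl h4
        · exact Or.inr (ht ⟨h1, h4⟩ h2 h3)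
    · exact ⟨⟨W, hW, hWY, hyW⟩, subset_rfl, fun _ => rfl, fun α hα => (h ⟨α, hα⟩).elim⟩
  choose step h1 h2 h3 using hstep
  let W : ℕ → S := fun n => Nat.rec ⟨∅, isClopen_empty, empty_subset _, by simp⟩ step n
  have hmono : Monotone fun n => (W n).1 := monotone_nat_of_le_succ fun n => h1 n (W n)
  refine ⟨fun n => (W n).1, fun n => (W n).2.1, fun n => (W n).2.2.1, fun n => (W n).2.2.2, rfl,
    hmono, fun x hx hxy => ?_, fun n => ⟨h2 n (W n), fun α hα => (h3 n (W n) α hα).1⟩⟩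
  obtain ⟨j, rfl⟩ := hu x
  obtain ⟨i, hi⟩ := he (u j)
  -- Stage n targets the point `u n.unpair.1`. At stage `pair j i` the index i of the rank of `u j`
  -- is already available, so the top rank is large enough to swallow `u j`.
  have hin : i ≤ Nat.pair j i := Nat.right_le_pair j i
  have hiδ : e i < rk y := by rw [hi]; exact hlt _ hx hxy
  obtain ⟨α, hα⟩ := exists_isTopBelow hin hiδ
  refine ⟨Nat.pair j i, ?_⟩
  have := (h3 (Nat.pair j i) (W (Nat.pair j i)) α hα).2
  simp only [Nat.unpair_pair] at this
  exact this hx hxy (by rw [← hi]; exact hα.2.2 i hin hiδ)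

/-- A clopen set with a single point of maximal rank is coded by the standard set of words of that
rank. -/
lemma IsRankFunction.exists_rankedWord_code [T1Space X] [Countable X] (hrk : IsRankFunction rk)
    (he : ∀ x, ∃ i, e i = rk x) (δ : Ordinal.{u}) : ∀ {Y : Set X}, IsClopen Y → ∀ {y : X}, y ∈ Y →
      rk y = δ → (∀ z ∈ Y, z ≠ y → rk z < δ) →
      ∃ φ : X → Word, ContinuousOn φ Y ∧ InjOn φ Y ∧ φ '' Y = {x | RankedWord e δ x} := by
  classical
  induction δ using WellFoundedLT.induction with
  | ind δ ih =>
  rintro Y hY y hy rfl hlt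
  obtain ⟨W, hW, hWY, hyW, hW0, hmono, hcov, hpiece⟩ := hrk.exists_exhaustion he hY hy hlt
  have hφ : ∀ n, ∃ φ : X → Word, ∀ α, IsTopBelow e (rk y) n α →
      ContinuousOn φ (W (n + 1) \ W n) ∧ InjOn φ (W (n + 1) \ W n) ∧
        φ '' (W (n + 1) \ W n) = {x | RankedWord e α x} := fun n => by
    by_cases h : ∃ α, IsTopBelow e (rk y) n α
    · obtain ⟨α, hα⟩ := h
      obtain ⟨v, hv, hvα, hvlt⟩ := (hpiece n).2 α hα
      obtain ⟨φ, hφ⟩ := ih α hα.2.1 ((hW (n + 1)).diff (hW n)) hv hvα hvlt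
      exact ⟨φ, fun β hβ => by rwa [hβ.unique hα]⟩
    · exact ⟨fun _ => 0, fun α hα => (h ⟨α, hα⟩).elim⟩
  choose φ hφ using hφ
  have htop : ∀ {n x}, x ∈ W (n + 1) \ W n → ∃ α, IsTopBelow e (rk y) n α := fun {n x} hx => by
    by_contra h
    rw [(hpiece n).1 h] at hx
    exact hx.2 hx.1
  -- The n-th layer gets the prefix 0ⁿ1 before its inductive code. Late layers tend to the zero
  -- word, the code of y.
  let Φ : X → Word := fun x => if h : ∃ n, x ∈ W (n + 1) then
    splice (Nat.find h) 0 1 (φ (Nat.find h) x) else 0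
  have hΦ : ∀ {n x}, x ∈ W (n + 1) \ W n → Φ x = splice n 0 1 (φ n x) := fun {n x} hx => by
    have h : ∃ n, x ∈ W (n + 1) := ⟨n, hx.1⟩
    have hn : Nat.find h = n := by
      rw [Nat.find_eq_iff]
      exact ⟨hx.1, fun m hm h' => hx.2 (hmono (Nat.succ_le_of_lt hm) h')⟩
    simp only [Φ, dif_pos h, hn]
  have hΦy : Φ y = 0 := dif_neg fun ⟨n, hn⟩ => hyW _ hn
  have hcases : ∀ x ∈ Y, x = y ∨ ∃ n, x ∈ W (n + 1) \ W n := fun x hx => by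
    by_cases hxy : x = y
    · exact Or.inl hxy
    · have h := hcov x hx hxy
      refine Or.inr ⟨Nat.find h, Nat.find_spec h, fun h' => ?_⟩
      rcases hm : Nat.find h with _ | m
      · rw [hm, hW0] at h'; exact h'
      · rw [hm] at h'
        exact Nat.find_min h (m := m) (by omega) h'
  have hne : ∀ {n x}, x ∈ W (n + 1) \ W n → Φ x n = 1 ∧ ∀ i < n, Φ x i = 0 := fun {n x} hx => by
    rw [hΦ hx]
    exact ⟨splice_self _ _ _ _, fun i hi => splice_of_lt hi _ _ _⟩
  refine ⟨Φ, fun x hx => ?_, fun x hx z hz hxz => ?_, Subset.antisymm ?_ fun w hw => ?_⟩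
  · rcases hcases x hx with rfl | ⟨n, hn⟩
    · refine ContinuousAt.continuousWithinAt (tendsto_pi_nhds.2 fun k => ?_)
      refine tendsto_nhds_of_eventually_eq ?_
      filter_upwards [(hY.diff (hW (k + 1))).isOpen.mem_nhds ⟨hx, hyW _⟩] with z hz
      rcases hcases z hz.1 with rfl | ⟨m, hm⟩
      · rfl
      · have hkm : k < m := by
          by_contra h
          exact hz.2 (hmono (by omega) hm.1)
        rw [(hne hm).2 k hkm, hΦy]
        rfl
    · obtain ⟨α, hα⟩ := htop hn
      have h1 : ContinuousOn Φ (W (n + 1) \ W n) :=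
        ((continuous_splice n 0 1).comp_continuousOn (hφ n α hα).1).congr fun z hz => hΦ hz
      exact (h1.continuousAt (((hW _).diff (hW n)).isOpen.mem_nhds hn)).continuousWithinAt
  · rcases hcases x hx with rfl | ⟨n, hn⟩ <;> rcases hcases z hz with rfl | ⟨m, hm⟩
    · rfl
    · have := (hne hm).1
      rw [← hxz, hΦy] at this
      exact absurd this (by simp)
    · have := (hne hn).1
      rw [hxz, hΦy] at this
      exact absurd this (by simp)
    · have hnm : n = m := by
        rcases lt_trichotomy n m with h | h | h
        · have := (hne hm).2 n h
          rw [← hxz, (hne hn).1] at this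
          exact absurd this (by simp)
        · exact h
        · have := (hne hn).2 m h
          rw [hxz, (hne hm).1] at this
          exact absurd this (by simp)
      subst hnm
      obtain ⟨α, hα⟩ := htop hn
      rw [hΦ hn, hΦ hm] at hxz
      exact (hφ n α hα).2.1 hn hm (splice_injective _ _ _ hxz)
  · rintro _ ⟨x, hx, rfl⟩
    rcases hcases x hx with rfl | ⟨n, hn⟩
    · rw [hΦy]; exact .zero _
    · obtain ⟨α, hα⟩ := htop hn
      rw [hΦ hn]
      refine .branch _ n α _ hα ?_
      have : φ n x ∈ φ n '' (W (n + 1) \ W n) := mem_image_of_mem _ hn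
      rwa [(hφ n α hα).2.2] at this
  · rcases hw with _ | ⟨_, n, α, w, hα, hw⟩
    · exact ⟨y, hy, hΦy⟩
    · have : w ∈ φ n '' (W (n + 1) \ W n) := by rw [(hφ n α hα).2.2]; exact hw
      obtain ⟨x, hx, rfl⟩ := this
      exact ⟨x, hWY _ hx.1, hΦ hx⟩

/-- Split off a clopen neighbourhood of one top point. Its codes never start with 2, so prefixing 2
to the codes of the remainder keeps the two parts apart. -/
lemma IsRankFunction.exists_multiRankedWord_code [T1Space X] [Countable X]
    (hrk : IsRankFunction rk) (he : ∀ x, ∃ i, e i = rk x) (δ : Ordinal.{u}) (m : ℕ) :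
    ∀ {Y : Set X}, IsClopen Y → (∀ z ∈ Y, rk z ≤ δ) → (Y ∩ {z | rk z = δ}).encard = (m + 1 : ℕ) →
      ∃ φ : X → Word, ContinuousOn φ Y ∧ InjOn φ Y ∧ φ '' Y = multiRankedWord e δ m := by
  classical
  induction m with
  | zero =>
    intro Y hY hle hcard
    obtain ⟨y, hy⟩ := encard_eq_one.1 (by simpa using hcard)
    have hy' : y ∈ Y ∩ {z | rk z = δ} := by rw [hy]; rfl
    refine hrk.exists_rankedWord_code he δ hY hy'.1 hy'.2 fun z hz hzy => ?_
    refine (hle z hz).lt_of_ne fun h => hzy ?_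
    have : z ∈ Y ∩ {z | rk z = δ} := ⟨hz, h⟩
    rwa [hy] at this
  | succ m ih =>
    intro Y hY hle hcard
    obtain ⟨y, hy⟩ : (Y ∩ {z | rk z = δ}).Nonempty := by
      rw [← encard_ne_zero, hcard]
      simp
    obtain ⟨V, hVY, hV, hyV, hlt⟩ := hrk.exists_clopen y Y hY.isOpen hy.1
    rw [hy.2] at hlt
    obtain ⟨φ, hφ1, hφ2, hφ3⟩ := hrk.exists_rankedWord_code he δ hV hyV hy.2 hlt
    have hcard' : ((Y \ V) ∩ {z | rk z = δ}).encard = (m + 1 : ℕ) := by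
      have h1 : Y ∩ {z | rk z = δ} = insert y ((Y \ V) ∩ {z | rk z = δ}) := by
        ext z
        constructor
        · rintro ⟨hz, hzδ⟩
          by_cases hzy : z = y
          · exact Or.inl hzy
          · exact Or.inr ⟨⟨hz, fun h => (hlt z h hzy).ne hzδ⟩, hzδ⟩
        · rintro (rfl | hz)
          · exact hy
          · exact ⟨hz.1.1, hz.2⟩
      rw [h1, encard_insert_of_notMem fun h => h.1.2 hyV] at hcard
      rw [Nat.cast_add _ 1, Nat.cast_one] at hcard
      exact ENat.add_left_injective_of_ne_top ENat.one_ne_top hcard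
    obtain ⟨ψ, hψ1, hψ2, hψ3⟩ := ih (hY.diff hV) (fun z hz => hle z hz.1) hcard'
    let Φ : X → Word := fun x => if x ∈ V then φ x else cons 2 (ψ x)
    have hΦV : ∀ x ∈ V, Φ x = φ x := fun x hx => if_pos hx
    have hΦV' : ∀ x ∈ Y \ V, Φ x = cons 2 (ψ x) := fun x hx => if_neg hx.2
    have hunion : Y = V ∪ Y \ V := (union_sdiff_cancel hVY).symm
    have h0 : ∀ x ∈ V, Φ x 0 ≠ 2 := fun x hx => by
      have : φ x ∈ φ '' V := mem_image_of_mem _ hx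
      rw [hφ3] at this
      rw [hΦV x hx]
      exact this.apply_ne_two
    have h2 : ∀ x ∈ Y \ V, Φ x 0 = 2 := fun x hx => by rw [hΦV' x hx, cons_zero]
    have hcons : Function.Injective (cons 2) := fun x z h => by
      rw [← tail_cons 2 x, h, tail_cons]
    refine ⟨Φ, ?_, ?_, ?_⟩
    · rw [hunion]
      refine ContinuousOn.union_of_isOpen (hφ1.congr hΦV)
        (((continuous_cons 2).comp_continuousOn hψ1).congr hΦV') hV.isOpen (hY.diff hV).isOpen
    · intro x hx z hz hxz
      by_cases hxV : x ∈ V <;> by_cases hzV : z ∈ V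
      · rw [hΦV x hxV, hΦV z hzV] at hxz
        exact hφ2 hxV hzV hxz
      · exact (h0 x hxV (by rw [hxz, h2 z ⟨hz, hzV⟩])).elim
      · exact (h0 z hzV (by rw [← hxz, h2 x ⟨hx, hxV⟩])).elim
      · rw [hΦV' x ⟨hx, hxV⟩, hΦV' z ⟨hz, hzV⟩] at hxz
        exact hψ2 ⟨hx, hxV⟩ ⟨hz, hzV⟩ (hcons hxz)
    · rw [hunion, image_union, image_congr hΦV, image_congr hΦV', hφ3,
        ← image_image (cons 2) ψ, hψ3]
      rfl

end RankedSpaces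

end FractalThm

/-! ### Cantor–Bendixson rank and the countable case -/

namespace FractalThm

open Set CantorBendixson

section PointRank

variable {X : Type u} [TopologicalSpace X]

/-- The Cantor-Bendixson rank of a point. -/
noncomputable def pointRank (x : X) : Ordinal.{u} :=
  sInf {α | x ∉ iteratedDerivedSet (univ : Set X) (α + 1)}

lemma mem_iteratedDerivedSet_iff (hker : perfectKernel (univ : Set X) = ∅) {x : X}
    {α : Ordinal.{u}} : x ∈ iteratedDerivedSet univ α ↔ α ≤ pointRank x := by
  have hanti := iteratedDerivedSet_antitone (univ : Set X)
  have hne : {α | x ∉ iteratedDerivedSet (univ : Set X) (α + 1)}.Nonempty := by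
    have : x ∉ perfectKernel (univ : Set X) := by simp [hker]
    obtain ⟨α, hα⟩ : ∃ α, x ∉ iteratedDerivedSet (univ : Set X) α := by
      simpa [perfectKernel] using this
    exact ⟨α, fun h => hα (hanti (by simp) h)⟩
  constructor
  · intro h
    by_contra! hlt
    exact csInf_mem hne (hanti (Order.add_one_le_of_lt hlt) h)
  · intro h
    refine hanti h ?_
    have hlow : ∀ β < pointRank x, x ∈ iteratedDerivedSet (univ : Set X) (β + 1) := fun β hβ =>
      not_not.1 (notMem_of_lt_csInf' hβ)
    rcases Ordinal.zero_or_succ_or_isSuccLimit (pointRank x) with h0 | ⟨β, hβ⟩ | hlim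
    · simp [h0]
    · rw [← hβ]
      exact hlow β (by rw [← hβ]; exact Order.lt_succ β)
    · rw [iteratedDerivedSet_limit hlim]
      exact mem_iInter.2 fun β => hanti (by simp) (hlow β.1 β.2)

lemma isRankFunction_pointRank [T1Space X] (hX : IsZeroDimensional X)
    (hker : perfectKernel (univ : Set X) = ∅) : IsRankFunction (pointRank : X → Ordinal.{u}) := by
  have hclopen : ∀ x, ∀ O : Set X, IsOpen O → x ∈ O →
      ∃ V ⊆ O, IsClopen V ∧ x ∈ V ∧ ∀ z ∈ V, z ≠ x → pointRank z < pointRank x := by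
    intro x O hO hxO
    have hx : x ∉ iteratedDerivedSet (univ : Set X) (pointRank x + 1) := by
      rw [mem_iteratedDerivedSet_iff hker]
      simp
    rw [iteratedDerivedSet_univ_succ, mem_derivedSet_iff_mem_closure] at hx
    obtain ⟨V, hV, hxV, hVO⟩ := hX.exists_subset_of_mem_open
      (show x ∈ O ∩ (closure (iteratedDerivedSet univ (pointRank x) \ {x}))ᶜ from ⟨hxO, hx⟩)
      (hO.inter isClosed_closure.isOpen_compl)
    refine ⟨V, fun z hz => (hVO hz).1, hV, hxV, fun z hz hzx => ?_⟩
    by_contra! h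
    exact (hVO hz).2 (subset_closure ⟨(mem_iteratedDerivedSet_iff hker).2 h, hzx⟩)
  refine ⟨hclopen, fun x O hO hxO α hα => ?_⟩
  by_contra! hne
  -- Infinite descent: if α is omitted in O, a point of rank at least α has rank above α, so it is a
  -- limit of points of rank at least α, and those close to it have smaller rank.
  have hwf : ∀ γ, ∀ z ∈ O, pointRank z = γ → ¬ α ≤ γ := by
    intro γ
    induction γ using WellFoundedLT.induction with
    | ind γ ih =>
    rintro z hz rfl hle
    obtain ⟨V, hVO, hV, hzV, hlt⟩ := hclopen z O hO hz
    have hz1 : z ∈ iteratedDerivedSet (univ : Set X) (α + 1) :=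
      (mem_iteratedDerivedSet_iff hker).2 (Order.add_one_le_of_lt (hle.lt_of_ne' (hne z hz)))
    rw [iteratedDerivedSet_univ_succ, mem_derivedSet_iff_mem_closure, mem_closure_iff] at hz1
    obtain ⟨w, hwV, hwα, hwz⟩ := hz1 V hV.isOpen hzV
    exact ih _ (hlt w hwV hwz) w (hVO hwV) rfl ((mem_iteratedDerivedSet_iff hker).1 hwα)
  exact hwf _ x hxO rfl hα.le

/-- A non-empty perfect set in a complete metric space contains a copy of the Cantor set. -/
lemma perfectKernel_eq_empty_of_countable [CompactSpace X] [TopologicalSpace.MetrizableSpace X]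
    [Countable X] : perfectKernel (univ : Set X) = ∅ := by
  let := TopologicalSpace.metrizableSpaceMetric X
  by_contra h
  obtain ⟨f, -, -, hf⟩ := (perfect_perfectKernel (isClosed_univ (X := X))).exists_nat_bool_injection
    (nonempty_iff_ne_empty.2 h)
  exact not_countable_nat_bool hf.countable

/-- A countable zero-dimensional compact metrizable space whose scattered height is not a limit
ordinal is homeomorphic to a shift-invariant set of words. -/
lemma exists_shift_code_of_countable [CompactSpace X] [TopologicalSpace.MetrizableSpace X]
    [Countable X] [Nonempty X] (hX : IsZeroDimensional X)
    (hlim : ¬ Order.IsSuccLimit (scatteredHeight X)) :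
    ∃ e : X → Word, Continuous e ∧ Function.Injective e ∧ ∀ x, tail (e x) ∈ range e := by
  have hker : perfectKernel (univ : Set X) = ∅ := perfectKernel_eq_empty_of_countable
  have hrk := isRankFunction_pointRank hX hker
  set β := scatteredHeight X with hβ
  have hfin : (iteratedDerivedSet (univ : Set X) β).Finite := by
    refine csInf_mem (s := {α : Ordinal.{u} | (iteratedDerivedSet (univ : Set X) α).Finite}) ?_
    obtain ⟨α, hα⟩ := iteratedDerivedSet_mem_fixedPoints (univ : Set X)
    refine ⟨α, ?_⟩
    rw [mem_ofPred_eq, ← perfectKernel_eq_iteratedDerivedSet_of_mem_fixedPoints hα, hker]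
    exact finite_empty
  have hinf : ∀ α < β, (iteratedDerivedSet (univ : Set X) α).Infinite := fun α hα h =>
    notMem_of_lt_csInf' hα h
  obtain ⟨u, hu⟩ := exists_surjective_nat X
  obtain ⟨hne, γ, hγ⟩ : (iteratedDerivedSet (univ : Set X) β).Nonempty ∧
      ∃ γ : Ordinal.{u}, β = 0 ∨ β = γ + 1 := by
    rcases Ordinal.zero_or_succ_or_isSuccLimit β with h0 | ⟨γ, hγ⟩ | h
    · exact ⟨by rw [h0, iteratedDerivedSet_zero]; exact univ_nonempty, 0, Or.inl h0⟩
    · have hγ' : β = γ + 1 := hγ.symm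
      refine ⟨?_, γ, Or.inr hγ'⟩
      rw [hγ', iteratedDerivedSet_univ_succ]
      exact (hinf γ (by rw [hγ']; exact Order.lt_add_one_iff.2 le_rfl)).exists_accPt_principal
    · exact (hlim h).elim
  -- A point of rank above β would have other points of rank β arbitrarily near, but the β-th
  -- derived set is finite.
  have hrank : ∀ x ∈ iteratedDerivedSet (univ : Set X) β, pointRank x = β := by
    intro x hx
    refine ((mem_iteratedDerivedSet_iff hker).1 hx).antisymm' (not_lt.1 fun hlt => ?_)
    obtain ⟨z, hz, hzβ⟩ := hrk.exists_rank_eq x (iteratedDerivedSet univ β \ {x})ᶜ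
      (hfin.sdiff.isClosed.isOpen_compl) (by simp) β hlt
    have hzx : z = x := by
      by_contra h
      exact hz ⟨(mem_iteratedDerivedSet_iff hker).2 hzβ.ge, h⟩
    rw [hzx] at hzβ
    exact hlt.ne hzβ.symm
  have hset : univ ∩ {z : X | pointRank z = β} = iteratedDerivedSet univ β := by
    ext x
    refine ⟨fun h => (mem_iteratedDerivedSet_iff hker).2 h.2.ge, fun h => ⟨trivial, hrank x h⟩⟩
  have hle : ∀ z ∈ (univ : Set X), pointRank z ≤ β := fun z _ => by
    by_contra! h
    exact h.ne' (hrank z ((mem_iteratedDerivedSet_iff hker).2 h.le))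
  obtain ⟨m, hm⟩ : ∃ m : ℕ, (iteratedDerivedSet (univ : Set X) β).encard = (m + 1 : ℕ) := by
    refine ⟨(iteratedDerivedSet (univ : Set X) β).ncard - 1, ?_⟩
    rw [Nat.sub_add_cancel ((ncard_pos hfin).2 hne), hfin.cast_ncard_eq]
  -- Listing γ first makes γ the top rank below β = γ + 1 at every stage, which is what
  -- shift-invariance needs. For β = 0 no rank lies below β.
  let e : ℕ → Ordinal.{u} := fun n => Nat.casesOn n γ fun k => pointRank (u k)
  have htop : ∀ n α, IsTopBelow e β (n + 1) α → IsTopBelow e β n α := by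
    rintro n α ⟨-, hα, hmax⟩
    rcases hγ with h0 | h1
    · rw [h0] at hα
      exact (not_lt_zero hα).elim
    · have hγβ : γ < β := by rw [h1]; exact Order.lt_add_one_iff.2 le_rfl
      have hαγ : α = γ := by
        rw [h1] at hα
        exact (Order.lt_add_one_iff.1 hα).antisymm (hmax 0 (by omega) hγβ)
      rw [hαγ]
      refine ⟨⟨0, by omega, rfl⟩, hγβ, fun i _ hi => ?_⟩
      rw [h1] at hi
      exact Order.lt_add_one_iff.1 hi
  obtain ⟨φ, h1, h2, h3⟩ := hrk.exists_multiRankedWord_code (e := e) (fun x => by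
    obtain ⟨k, rfl⟩ := hu x
    exact ⟨k + 1, rfl⟩) β m isClopen_univ hle (by rw [hset, hm])
  rw [image_univ] at h3
  refine ⟨φ, continuousOn_univ.1 h1, injOn_univ.1 h2, fun x => ?_⟩
  rw [h3]
  refine tail_mem_multiRankedWord htop m _ ?_
  rw [← h3]
  exact mem_range_self x

end PointRank

lemma exists_shift_code {X : Type u} [TopologicalSpace X] [CompactSpace X]
    [TopologicalSpace.MetrizableSpace X] [Nonempty X] (hX : IsZeroDimensional X)
    (h : Uncountable X ∨ (Countable X ∧ ¬ Order.IsSuccLimit (scatteredHeight X))) :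
    ∃ e : X → Word, Continuous e ∧ Function.Injective e ∧ ∀ x, tail (e x) ∈ range e := by
  rcases h with h | ⟨hc, hlim⟩
  · have : TotallySeparatedSpace X := totallySeparatedSpace_of_t0_of_basis_clopen hX
    let := TopologicalSpace.metrizableSpaceMetric X
    exact exists_shift_code_of_uncountable h
  · exact exists_shift_code_of_countable hX hlim

end FractalThm

theorem mainTheorem11 (X : Type u) [TopologicalSpace X] [CompactSpace X]
    [TopologicalSpace.MetrizableSpace X] [Nonempty X] (hX : FractalThm.IsZeroDimensional X) :
    List.TFAE [
      ∃ F : Set C(X, X), FractalThm.IsTopologicalFractal F,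
      ∃ F : Set C(X, X), FractalThm.IsStrictTopologicalUltrafractal F ∧
        (F.ncard = 3 ∨ (ENat.card X < 3 ∧ F.ncard ≤ 3)),
      ∀ ε : ℝ, 0 < ε → ∃ F : Set (ℝ → ℝ), F.ncard = 3 ∧
        (∀ f ∈ F, FractalThm.IsEpsContraction ε f) ∧
        ∃ K : Set ℝ, FractalThm.IsAttractor F K ∧ Nonempty (X ≃ₜ K),
      Uncountable X ∨
        (Countable X ∧ ¬ Order.IsSuccLimit (FractalThm.scatteredHeight X))] := by
  tfae_have 1 → 4 := fun ⟨F, hF⟩ => by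
    by_cases h : Countable X
    · exact Or.inr ⟨h, hF.not_isSuccLimit_scatteredHeight⟩
    · exact Or.inl (not_countable_iff.1 h)
  tfae_have 2 → 1 := fun ⟨F, hF, _⟩ => ⟨F, hF.toIsTopologicalFractal⟩
  tfae_have 3 → 1 := fun h => by
    obtain ⟨F, hcard, hF, K, hK, ⟨φ⟩⟩ := h (1 / 2) (by norm_num)
    exact FractalThm.exists_topologicalFractal_of_attractor (by norm_num) (by norm_num)
      (Set.finite_of_ncard_ne_zero (by omega)) hF hK φ
  tfae_have 4 → 2 := fun h => by
    obtain ⟨e, he, hi, hs⟩ := FractalThm.exists_shift_code hX h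
    exact FractalThm.exists_strictTopologicalUltrafractal he hi hs
  tfae_have 4 → 3 := fun h ε hε => by
    obtain ⟨e, he, hi, hs⟩ := FractalThm.exists_shift_code hX h
    exact FractalThm.exists_attractor_homeomorph he hi hs hε
  tfae_finish
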